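/- Let $n\ge 3$. Let $\widetilde\Delta$ be a finite disjoint union of oriented Euclidean $n$-simplices, and let $\Phi$ be a family of orientation-reversing affine isomorphisms that pairs its facets: it is closed under inverses, each facet $\tau$ is the domain of exactly one $\varphi_\tau\in\Phi$, and $\varphi_\tau(\tau)\neq\tau$. Suppose that the quotient $\widehat M=\widetilde\Delta/\Phi$ is connected and that the triangulation is even: the image of each $(n-2)$-simplex has even degree (the number of preimages in $\widetilde\Delta$ of a generic point of it is even). Write $\widehat M^{(j)}$ for the image of the $j$-skeleton of $\widetilde\Delta$ and $M_j=\widehat M\setminus\widehat M^{(j)}$ for $0\le j\le n-3$; thus $M=M_0$ is the complement of the vertices. Fix an $n$-simplex $\sigma_0$, let $x_0$ be the image of its barycentre, and let $2\le k\le\frac{n+1}2$. The perspectivity $p_\tau\colon\sigma\to\sigma'$ across a facet $\tau$ of $\sigma$, where $\varphi_\tau(\tau)$ is a facet of $\sigma'$, is the bijection of corners that extends $\varphi_\tau$ and maps the corner opposite to $\tau$ to the corner opposite to $\varphi_\tau(\tau)$. The projectivity $p_\gamma\in\operatorname{Sym}(\sigma_0)$ of a loop $\gamma$ based at $x_0$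 in the dual graph is the composition of the perspectivities across the facets that $\gamma$ crosses. A canonical symmetric representation of $\pi_1(M_j,x_0)$ is a homomorphism $\rho\colon\pi_1(M_j,x_0)\to\operatorname{Sym}(\sigma_0)$ with $\rho([\gamma])=p_\gamma$ for every such $\gamma$. It induces an action $\rho_{k|n-k+1}\colon\pi_1(M_j,x_0)\to\operatorname{Sym}(N)$ on the $N$ unordered partitions of the $n+1$ corners of $\sigma_0$ into two sets of sizes $k$ and $n-k+1$ (the $(k,n-k+1)$-normal disc types in $\sigma_0$). Here $N=\binom{n+1}k$ if $2k\neq n+1$, and $N=\frac12\binom{n+1}k$ if $2k=n+1$. The standard normal disc of type $\{A,B\}$ in a simplex is the convex hull of the midpoints of the edges with one endpoint in $A$ and the other in $B$. The $(k,n-k+1)$-hypersurface $Q$ is obtained from one standard normal disc of each $(k,n-k+1)$-type in each $n$-simplex by gluing, for each facet $\tau$, the disc of type $\nu$ along its intersection with $\tau$ to the disc of type $p_\tau(\nu)$ via $\varphi_\tau$; it has a natural map $Q\to\widehat M$. Then for every $0\le j\le n-3$ the following hold. (0) If $n=3$ (so $j=0$), there is a unique canonical symmetric representation of $\pi_1(M_j,x_0)$.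 The same is true for $n\ge4$ if no $(n-2)$-simplex is identified with itself by a nontrivial permutation of its corners and the inclusion $M_{n-3}\subseteq M_j$ induces an injection of fundamental groups (which is trivially the case for $j=n-3$). Moreover, let $\rho$ be any canonical symmetric representation of $\pi_1(M_j,x_0)$. (1) The induced representation $\rho_{k|n-k+1}$ leaves each component of $Q$ invariant: for each component $C$ of $Q$ and each $g\in\pi_1(M_j,x_0)$, the permutation $\rho_{k|n-k+1}(g)$ maps the set of types of discs of $C$ in $\sigma_0$ onto itself. (2) The image of $\rho_{k|n-k+1}$ is trivial if and only if $Q$ has exactly $N$ components. (3) If $Q$ has exactly $N$ components, then each component $C$ is an embedded normal hypersurface in $\widehat M$: it is a nonempty union of normal discs, its normal coordinate (weight $1$ on the disc types whose discs belong to $C$, weight $0$ on all others) satisfies the matching equations, and the natural map $Q\to\widehat M$ restricts to a topological embedding of $C$. The matching equations for weights $x_\nu$ of normal disc types $\nu$ (partitions of the corners of a simplex into two nonempty sets) say that, for each facet $\tau$ and each partition $\mu$ of its corners into two nonempty sets, the sum of $x_\nu$ over the $\nu$ in the simplex containing $\tau$ that restrict to $\mu$ on $\tau$ is equal to the sum of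 $x_\nu$ over the $\nu$ in the simplex containing $\varphi_\tau(\tau)$ that restrict to $\varphi_\tau(\mu)$ on $\varphi_\tau(\tau)$. -/

import Mathlib

open Set

noncomputable section

/-- Face pairings on a family `S` of standard `n`-simplices. A facet is a pair `(σ, i)`: the facet
of the simplex `σ` opposite to its corner `i`. The affine isomorphism from the facet `τ` onto the
facet `pairing τ` is determined by its effect `glue τ` on the corners of `τ`. -/
structure FacePairing (n : ℕ) (S : Type*) where
  pairing : S × Fin (n + 1) → S × Fin (n + 1)
  glue : ∀ τ : S × Fin (n + 1),
    {v : Fin (n + 1) // v ≠ τ.2} ≃ {w : Fin (n + 1) // w ≠ (pairing τ).2}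
  pairing_pairing : ∀ τ, pairing (pairing τ) = τ
  pairing_ne : ∀ τ, pairing τ ≠ τ
  glue_glue : ∀ τ v, (glue (pairing τ) (glue τ v) : Fin (n + 1)) = v

/-- The perspectivity across the facet `τ`: it extends the face pairing with domain `τ` by mapping
the corner opposite to `τ` to the corner opposite to the image of `τ`. -/
def FacePairing.perspectivity {n : ℕ} {S : Type*} (T : FacePairing n S) (τ : S × Fin (n + 1)) :
    Equiv.Perm (Fin (n + 1)) where
  toFun v := if h : v = τ.2 then (T.pairing τ).2 else T.glue τ ⟨v, h⟩
  invFun w := if h : w = (T.pairing τ).2 then τ.2 else (T.glue τ).symm ⟨w, h⟩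
  left_inv v := by
    by_cases h : v = τ.2
    · simp [h]
    · have h' := (T.glue τ ⟨v, h⟩).2
      simp [h, h']
  right_inv w := by
    by_cases h : w = (T.pairing τ).2
    · simp [h]
    · have h' := ((T.glue τ).symm ⟨w, h⟩).2
      simp [h, h']

/-- A (singular) triangulation of a closed oriented `n`-dimensional pseudo-manifold. The sign
`orientation σ` compares the orientation of the simplex `σ` with the one given by the ordering of
its corners. A face pairing reverses the induced orientations of the facets if and only if the
perspectivity (a reflection across the facet) reverses the orientations of the simplices. -/
structure Triangulation (n : ℕ) (S : Type*) extends FacePairing n S where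
  orientation : S → ℤˣ
  orientation_reversing : ∀ τ : S × Fin (n + 1),
    orientation τ.1 * Equiv.Perm.sign (toFacePairing.perspectivity τ) *
      orientation (pairing τ).1 = -1

namespace Triangulation

variable {n : ℕ} {S : Type*}

/-! ### The pseudo-manifold, its skeleta and their complements -/

/-- The disjoint union of the simplices. -/
abbrev Points (_T : Triangulation n S) : Type _ :=
  Σ _ : S, stdSimplex ℝ (Fin (n + 1))

/-- A point `y` of a simplex is the image of the point `x` under a face pairing. -/
def Identifies (T : Triangulation n S) (x y : T.Points) : Prop :=
  ∃ i : Fin (n + 1), x.2 i = 0 ∧ y.1 = (T.pairing (x.1, i)).1 ∧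
    ∀ v, y.2 (T.perspectivity (x.1, i) v) = x.2 v

/-- The pseudo-manifold: the quotient of the disjoint union of the simplices by the equivalence
relation that is generated by the face pairings, with the quotient topology. -/
abbrev Space (T : Triangulation n S) : Type _ := Quot T.Identifies

/-- The projection from the disjoint union of the simplices. -/
abbrev proj (T : Triangulation n S) (σ : S) (x : stdSimplex ℝ (Fin (n + 1))) : T.Space :=
  Quot.mk _ ⟨σ, x⟩

/-- The number of nonzero barycentric coordinates; a point lies in a face of dimension at most `j`
if and only if this number is at most `j + 1`. -/
def suppCard (x : stdSimplex ℝ (Fin (n + 1))) : ℕ := {v | x v ≠ 0}.ncard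

/-- The image of the `j`-skeleton under the projection. -/
def skeleton (T : Triangulation n S) (j : ℕ) : Set T.Space :=
  {q | ∃ σ x, suppCard x ≤ j + 1 ∧ T.proj σ x = q}

/-- The complement of the `j`-skeleton in the pseudo-manifold. -/
abbrev Complement (T : Triangulation n S) (j : ℕ) : Type _ := {q : T.Space // q ∉ T.skeleton j}

theorem suppCard_eq_of_identifies (T : Triangulation n S) {x y : T.Points}
    (h : T.Identifies x y) : suppCard x.2 = suppCard y.2 := by
  obtain ⟨i, -, -, h⟩ := h
  unfold suppCard
  have : {v | y.2 v ≠ 0} = T.perspectivity (x.1, i) '' {v | x.2 v ≠ 0} := by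
    ext v
    constructor
    · intro hv
      refine ⟨(T.perspectivity (x.1, i)).symm v, ?_, by simp⟩
      have := h ((T.perspectivity (x.1, i)).symm v)
      simp only [Equiv.apply_symm_apply] at this
      simpa [← this] using hv
    · rintro ⟨w, hw, rfl⟩
      simpa [h w] using hw
  rw [this, Set.ncard_image_of_injective _ (Equiv.injective _)]

theorem proj_notMem_skeleton (T : Triangulation n S) {j : ℕ} (σ : S)
    {x : stdSimplex ℝ (Fin (n + 1))} (hx : j + 1 < suppCard x) : T.proj σ x ∉ T.skeleton j := by
  rintro ⟨σ', x', hx', he⟩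
  have := congrArg (Quot.lift (fun y : T.Points => suppCard y.2)
    fun _ _ h => T.suppCard_eq_of_identifies h) he
  simp only at this
  omega

/-- The inclusion of the complement of a skeleton into the complement of a smaller one. -/
def inclusion (T : Triangulation n S) {j j' : ℕ} (h : j ≤ j') :
    C(T.Complement j', T.Complement j) where
  toFun q := ⟨q.1, fun ⟨σ, x, hx, he⟩ => q.2 ⟨σ, x, by omega, he⟩⟩
  continuous_toFun := Continuous.subtype_mk continuous_subtype_val _

/-! ### The dual graph and projectivities -/

/-- The point on the segment from the barycentre of a simplex (`t = 0`) to the barycentre of its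
facet opposite to the corner `i` (`t = 1`). -/
def halfEdgePoint (hn : 3 ≤ n) (i : Fin (n + 1)) (t : unitInterval) :
    stdSimplex ℝ (Fin (n + 1)) :=
  ⟨fun v => (1 - (t : ℝ)) * ((n : ℝ) + 1)⁻¹ + (t : ℝ) * (if v = i then 0 else (n : ℝ)⁻¹), by
    have hn0 : (n : ℝ) ≠ 0 := by
      have : n ≠ 0 := by omega
      exact_mod_cast this
    have hn1 : (n : ℝ) + 1 ≠ 0 := by positivity
    constructor
    · intro v
      have h0 := t.2.1
      have h1 : 0 ≤ 1 - (t : ℝ) := sub_nonneg.2 t.2.2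
      dsimp only
      split_ifs <;> positivity
    · rw [Finset.sum_add_distrib, ← Finset.mul_sum, ← Finset.mul_sum]
      have : ∑ v : Fin (n + 1), (if v = i then (0 : ℝ) else (n : ℝ)⁻¹) = 1 := by
        rw [← Finset.add_sum_erase _ _ (Finset.mem_univ i), if_pos rfl, zero_add,
          Finset.sum_congr rfl (g := fun _ => (n : ℝ)⁻¹)
            (fun v hv => if_neg (Finset.ne_of_mem_erase hv))]
        simp [hn0]
      rw [this]
      simp
      field_simp
      ring⟩

theorem lt_suppCard_halfEdgePoint (hn : 3 ≤ n) {j : ℕ} (hj : j + 3 ≤ n) (i : Fin (n + 1))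
    (t : unitInterval) : j + 1 < suppCard (halfEdgePoint hn i t) := by
  have hsub : {v | v ≠ i} ⊆ {v | halfEdgePoint hn i t v ≠ 0} := by
    intro v hv
    have hv' : v ≠ i := hv
    have h0 := t.2.1
    have h1 : 0 ≤ 1 - (t : ℝ) := sub_nonneg.2 t.2.2
    have hn0 : (0 : ℝ) < n := by
      have : 0 < n := by omega
      exact_mod_cast this
    change (1 - (t : ℝ)) * ((n : ℝ) + 1)⁻¹ + (t : ℝ) * (if v = i then 0 else (n : ℝ)⁻¹) ≠ 0
    rw [if_neg hv']
    rcases eq_or_lt_of_le h0 with h | h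
    · rw [← h]
      simp
      positivity
    · positivity
  have hcard : {v : Fin (n + 1) | v ≠ i}.ncard = n := by
    have : {v : Fin (n + 1) | v ≠ i} = ({i} : Set (Fin (n + 1)))ᶜ := rfl
    rw [this, Set.ncard_compl]
    simp
  have := Set.ncard_le_ncard hsub (Set.toFinite _)
  unfold suppCard
  omega

theorem continuous_halfEdgePoint (hn : 3 ≤ n) (i : Fin (n + 1)) :
    Continuous (halfEdgePoint hn i) := by
  unfold halfEdgePoint
  refine Continuous.subtype_mk (continuous_pi fun v => ?_) _
  fun_prop

/-- The barycentre of `σ` and the barycentres of its facets lie outside the `j`-skeleton, and so do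
the segments between them. -/
def halfEdgeMap (T : Triangulation n S) {j : ℕ} (hj : j + 3 ≤ n) (σ : S) (i : Fin (n + 1))
    (t : unitInterval) : T.Complement j :=
  ⟨T.proj σ (halfEdgePoint (by omega) i t),
    T.proj_notMem_skeleton σ (lt_suppCard_halfEdgePoint _ hj i t)⟩

theorem continuous_halfEdgeMap (T : Triangulation n S) {j : ℕ} (hj : j + 3 ≤ n) (σ : S)
    (i : Fin (n + 1)) : Continuous (T.halfEdgeMap hj σ i) :=
  Continuous.subtype_mk (continuous_quot_mk.comp
    ((continuous_sigmaMk (σ := fun _ : S => stdSimplex ℝ (Fin (n + 1)))).comp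
      (continuous_halfEdgePoint _ i))) _

/-- The barycentre of the simplex `σ`, a vertex of the dual graph. -/
def center (T : Triangulation n S) {j : ℕ} (hj : j + 3 ≤ n) (σ : S) : T.Complement j :=
  T.halfEdgeMap hj σ 0 0

theorem halfEdgeMap_zero (T : Triangulation n S) {j : ℕ} (hj : j + 3 ≤ n) (σ : S)
    (i : Fin (n + 1)) : T.halfEdgeMap hj σ i 0 = T.center hj σ := by
  simp [center, halfEdgeMap, halfEdgePoint]

theorem perspectivity_self (T : Triangulation n S) (τ : S × Fin (n + 1)) :
    T.perspectivity τ τ.2 = (T.pairing τ).2 := by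
  simp [FacePairing.perspectivity]

theorem halfEdgeMap_one (T : Triangulation n S) {j : ℕ} (hj : j + 3 ≤ n) (σ : S)
    (i : Fin (n + 1)) : T.halfEdgeMap hj σ i 1 =
      T.halfEdgeMap hj (T.pairing (σ, i)).1 (T.pairing (σ, i)).2 1 := by
  refine Subtype.ext (Quot.sound ⟨i, ?_, rfl, fun v => ?_⟩)
  · change (1 - ((1 : unitInterval) : ℝ)) * _ + ((1 : unitInterval) : ℝ) * (if i = i then 0 else _)
      = (0 : ℝ)
    simp
  · change (1 - ((1 : unitInterval) : ℝ)) * _ + ((1 : unitInterval) : ℝ) *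
        (if T.perspectivity (σ, i) v = (T.pairing (σ, i)).2 then 0 else (n : ℝ)⁻¹)
      = (1 - ((1 : unitInterval) : ℝ)) * _ + ((1 : unitInterval) : ℝ) *
        (if v = i then 0 else (n : ℝ)⁻¹)
    rw [← T.perspectivity_self (σ, i)]
    simp

/-- Half an edge of the dual graph, from the barycentre of `σ` to that of its facet `i`. -/
def halfEdge (T : Triangulation n S) {j : ℕ} (hj : j + 3 ≤ n) (σ : S) (i : Fin (n + 1)) :
    Path (T.center hj σ) (T.halfEdgeMap hj σ i 1) where
  toFun := T.halfEdgeMap hj σ i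
  continuous_toFun := T.continuous_halfEdgeMap hj σ i
  source' := T.halfEdgeMap_zero hj σ i
  target' := rfl

/-- The edge of the dual graph that leaves `σ` through its facet `i`. -/
def dualEdge (T : Triangulation n S) {j : ℕ} (hj : j + 3 ≤ n) (σ : S) (i : Fin (n + 1)) :
    Path (T.center hj σ) (T.center hj (T.pairing (σ, i)).1) :=
  (T.halfEdge hj σ i).trans
    ((T.halfEdge hj (T.pairing (σ, i)).1 (T.pairing (σ, i)).2).symm.cast
      (T.halfEdgeMap_one hj σ i) rfl)

/-- Facet paths: finite sequences of consecutive crossings of facets, that is, edge paths in the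
dual graph. -/
inductive FacetPath (T : Triangulation n S) : S → S → Type _
  | nil (σ : S) : FacetPath T σ σ
  | cons {σ σ' : S} (i : Fin (n + 1)) (γ : FacetPath T (T.pairing (σ, i)).1 σ') : FacetPath T σ σ'

/-- The projectivity of a facet path: the composition of the perspectivities across its facets. -/
def FacetPath.projectivity {T : Triangulation n S} :
    {σ σ' : S} → T.FacetPath σ σ' → Equiv.Perm (Fin (n + 1))
  | _, _, .nil _ => 1
  | σ, _, .cons i γ => γ.projectivity * T.perspectivity (σ, i)

/-- The path in the dual graph that crosses the facets of a facet path. -/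
def FacetPath.toPath {T : Triangulation n S} {j : ℕ} (hj : j + 3 ≤ n) :
    {σ σ' : S} → T.FacetPath σ σ' → Path (T.center hj σ) (T.center hj σ')
  | _, _, .nil σ => Path.refl (T.center hj σ)
  | σ, _, .cons i γ => (T.dualEdge hj σ i).trans (γ.toPath hj)

/-- `ρ` is the canonical symmetric representation of the fundamental group of the complement of the
`j`-skeleton: it maps the class of each loop `γ` in the dual graph, based at the barycentre of `σ₀`,
to the projectivity of `γ`, a permutation of the corners of `σ₀`. -/
def IsCanonicalRep (T : Triangulation n S) {j : ℕ} (hj : j + 3 ≤ n) (σ₀ : S)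
    (ρ : FundamentalGroup (T.Complement j) (T.center hj σ₀) →* Equiv.Perm (Fin (n + 1))) : Prop :=
  ∀ γ : T.FacetPath σ₀ σ₀,
    ρ (FundamentalGroup.fromPath (Path.Homotopic.Quotient.mk (γ.toPath hj))) = γ.projectivity

/-! ### Even triangulations -/

/-- An `(n-2)`-simplex of the disjoint union together with an ordering of its corners. -/
abbrev OrderedFace (_T : Triangulation n S) : Type _ := S × (Fin (n - 1) ↪ Fin (n + 1))

/-- `g` is the image of the ordered face `f` under a face pairing of a facet that contains `f`. -/
def FaceIdentifies (T : Triangulation n S) (f g : T.OrderedFace) : Prop :=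
  ∃ i : Fin (n + 1), i ∉ range f.2 ∧ g.1 = (T.pairing (f.1, i)).1 ∧
    ∀ a, g.2 a = T.perspectivity (f.1, i) (f.2 a)

/-- The degree of the `(n-2)`-singlex that is the image of the face `f`: the number of preimages of
a generic point of it. They correspond to the ordered faces that are identified with `f`. -/
def degree (T : Triangulation n S) (f : T.OrderedFace) : ℕ :=
  {g | Relation.EqvGen T.FaceIdentifies f g}.ncard

/-- Every `(n-2)`-singlex has even degree. -/
def IsEven (T : Triangulation n S) : Prop := ∀ f : T.OrderedFace, Even (T.degree f)

/-- No `(n-2)`-simplex is identified with itself by a nontrivial permutation of its corners. -/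
def NoFolding (T : Triangulation n S) : Prop :=
  ∀ (σ : S) (e e' : Fin (n - 1) ↪ Fin (n + 1)),
    Relation.EqvGen T.FaceIdentifies (σ, e) (σ, e') → range e = range e' → e = e'

end Triangulation

/-! ### Normal disc types -/

/-- A normal disc type in an `n`-simplex: an unordered partition of its corners into two nonempty
sets. -/
def NormalDiscType (n : ℕ) : Type :=
  {ν : Sym2 (Finset (Fin (n + 1))) // ∃ A : Finset (Fin (n + 1)),
    A.Nonempty ∧ Aᶜ.Nonempty ∧ s(A, Aᶜ) = ν}

namespace NormalDiscType

variable {n : ℕ}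

instance : Finite (NormalDiscType n) := inferInstanceAs (Finite (Subtype _))

instance : Fintype (NormalDiscType n) := Fintype.ofFinite _

/-- The partition has one part with `k` elements (and the other one with `n + 1 - k`). -/
def IsType (k : ℕ) (ν : NormalDiscType n) : Prop :=
  ∃ A : Finset (Fin (n + 1)), A.card = k ∧ s(A, Aᶜ) = ν.1

/-- The image of a partition under a permutation of the corners. -/
def map (π : Equiv.Perm (Fin (n + 1))) (ν : NormalDiscType n) : NormalDiscType n :=
  ⟨ν.1.map (Finset.map π.toEmbedding), by
    obtain ⟨_, A, hA, hA', rfl⟩ := ν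
    refine ⟨A.map π.toEmbedding, by simpa using hA, ?_, ?_⟩
    · obtain ⟨a, ha⟩ := hA'
      exact ⟨π a, by simpa using ha⟩
    · have : (A.map π.toEmbedding)ᶜ = Aᶜ.map π.toEmbedding := by
        ext v
        simp
      rw [this]
      rfl⟩

theorem IsType.map {k : ℕ} (π : Equiv.Perm (Fin (n + 1))) {ν : NormalDiscType n}
    (h : ν.IsType k) : (ν.map π).IsType k := by
  obtain ⟨A, hA, h⟩ := h
  refine ⟨A.map π.toEmbedding, by simpa using hA, ?_⟩
  have : (A.map π.toEmbedding)ᶜ = Aᶜ.map π.toEmbedding := by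
    ext v
    simp
  rw [this]
  change _ = ν.1.map (Finset.map π.toEmbedding)
  rw [← h]
  rfl

theorem map_one (ν : NormalDiscType n) : ν.map 1 = ν := by
  apply Subtype.ext
  change ν.1.map (Finset.map _) = ν.1
  have : Finset.map (Equiv.toEmbedding (1 : Equiv.Perm (Fin (n + 1)))) = id := by
    funext A
    exact Finset.map_refl
  rw [this, Sym2.map_id, id]

theorem map_mul (π π' : Equiv.Perm (Fin (n + 1))) (ν : NormalDiscType n) :
    ν.map (π * π') = (ν.map π').map π := by
  apply Subtype.ext
  change ν.1.map _ = (ν.1.map _).map _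
  rw [Sym2.map_map]
  congr 1
  funext A
  simp [Finset.map_map]
  rfl

/-- The intersection of a normal disc type with the facet opposite to the corner `i`, as a partition
of the corners of that facet (one part is empty if the disc does not meet the facet). -/
def trace (ν : NormalDiscType n) (i : Fin (n + 1)) : Sym2 (Finset (Fin (n + 1))) :=
  ν.1.map fun A => A.erase i

/-- The corners `a` and `b` lie in different parts of the partition. -/
def Separates (ν : NormalDiscType n) (a b : Fin (n + 1)) : Prop :=
  ∃ A : Finset (Fin (n + 1)), s(A, Aᶜ) = ν.1 ∧ a ∈ A ∧ b ∉ A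

/-- The standard normal disc of type `ν`: the convex hull of the midpoints of all edges whose
endpoints lie in different parts of the partition. -/
def disc (ν : NormalDiscType n) : Set (Fin (n + 1) → ℝ) :=
  convexHull ℝ {m | ∃ a b, ν.Separates a b ∧ m = midpoint ℝ (Pi.single a 1 : Fin (n + 1) → ℝ) (Pi.single b 1)}

end NormalDiscType

/-- The `(k, n-k+1)`-normal disc types. -/
abbrev DiscType (n k : ℕ) : Type := {ν : NormalDiscType n // ν.IsType k}

/-- The action of the permutations of the corners on the `(k, n-k+1)`-normal disc types. -/
def discAction (n k : ℕ) : Equiv.Perm (Fin (n + 1)) →* Equiv.Perm (DiscType n k) where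
  toFun π :=
    { toFun := fun ν => ⟨ν.1.map π, ν.2.map π⟩
      invFun := fun ν => ⟨ν.1.map π⁻¹, ν.2.map π⁻¹⟩
      left_inv := fun ν => Subtype.ext (by
        simp only [← NormalDiscType.map_mul, inv_mul_cancel, NormalDiscType.map_one])
      right_inv := fun ν => Subtype.ext (by
        simp only [← NormalDiscType.map_mul, mul_inv_cancel, NormalDiscType.map_one]) }
  map_one' := Equiv.ext fun ν => Subtype.ext (NormalDiscType.map_one ν.1)
  map_mul' π π' := Equiv.ext fun ν => Subtype.ext (NormalDiscType.map_mul π π' ν.1)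

/-- The representation induced by `ρ` on the partitions into sets of sizes `k` and `n-k+1`. -/
def inducedRep {n : ℕ} {G : Type*} [Group G] (ρ : G →* Equiv.Perm (Fin (n + 1))) (k : ℕ) :
    G →* Equiv.Perm (DiscType n k) :=
  (discAction n k).comp ρ

/-- The number `N` of unordered partitions of `n + 1` letters into sets of sizes `k` and
`n-k+1`. -/
def numPartitions (n k : ℕ) : ℕ :=
  if 2 * k = n + 1 then (n + 1).choose k / 2 else (n + 1).choose k

namespace Triangulation

variable {n : ℕ} {S : Type*}

/-! ### Normal hypersurfaces -/

/-- The disjoint union of all standard normal `(k, n-k+1)`-discs, one of each type in each simplex.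
-/
abbrev DiscPoints (_T : Triangulation n S) (k : ℕ) : Type _ :=
  Σ d : S × DiscType n k, {x : stdSimplex ℝ (Fin (n + 1)) // (x : Fin (n + 1) → ℝ) ∈ d.2.1.disc}

/-- The disc `(σ, ν)` is glued, along its intersection with the facet `i` of `σ`, to the image of
`ν` under the perspectivity across this facet, by means of the face pairing. -/
def DiscIdentifies (T : Triangulation n S) (k : ℕ) (x y : T.DiscPoints k) : Prop :=
  ∃ i : Fin (n + 1), x.2.1 i = 0 ∧ y.1.1 = (T.pairing (x.1.1, i)).1 ∧
    y.1.2 = discAction n k (T.perspectivity (x.1.1, i)) x.1.2 ∧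
    ∀ v, y.2.1 (T.perspectivity (x.1.1, i) v) = x.2.1 v

/-- The `(k, n-k+1)`-hypersurface. -/
abbrev Hypersurface (T : Triangulation n S) (k : ℕ) : Type _ := Quot (T.DiscIdentifies k)

/-- The natural map of the `(k, n-k+1)`-hypersurface to the pseudo-manifold. -/
def Hypersurface.toSpace (T : Triangulation n S) (k : ℕ) : T.Hypersurface k → T.Space :=
  Quot.lift (fun x => T.proj x.1.1 x.2.1) fun _ _ ⟨i, h0, h1, _, h2⟩ =>
    Quot.sound ⟨i, h0, h1, h2⟩

/-- The disc of type `ν` in `σ`, as a subset of the `(k, n-k+1)`-hypersurface. -/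
def cell (T : Triangulation n S) {k : ℕ} (σ : S) (ν : DiscType n k) : Set (T.Hypersurface k) :=
  range fun x => Quot.mk _ ⟨(σ, ν), x⟩

/-- The types of the discs in `σ` that belong to the subset `C` of the hypersurface. -/
def discTypes (T : Triangulation n S) {k : ℕ} (C : Set (T.Hypersurface k)) (σ : S) :
    Set (DiscType n k) :=
  {ν | T.cell σ ν ⊆ C}

open Classical in
/-- The matching equations: for each facet `i` of each simplex `σ` and each normal disc type
`s(B, B')` of this facet, the total weight of the normal disc types in `σ` that meet the facet in
`s(B, B')` is equal to the total weight of those that meet the paired facet in its image. -/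
def MatchingEquations (T : Triangulation n S) (x : S → NormalDiscType n → ℕ) : Prop :=
  ∀ (σ : S) (i : Fin (n + 1)) (B B' : Finset (Fin (n + 1))),
    B.Nonempty → B'.Nonempty → Disjoint B B' → B ∪ B' = Finset.univ.erase i →
    ∑ ν with ν.trace i = s(B, B'), x σ ν =
      ∑ ν with ν.trace (T.pairing (σ, i)).2 =
          s(B, B').map (Finset.map (T.perspectivity (σ, i)).toEmbedding),
        x (T.pairing (σ, i)).1 ν

open Classical in
/-- The normal coordinate of the subset `C` of the hypersurface: the weight of a disc type is one if
the corresponding disc belongs to `C`, and zero otherwise. -/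
def normalCoordinate (T : Triangulation n S) {k : ℕ} (C : Set (T.Hypersurface k)) (σ : S)
    (ν : NormalDiscType n) : ℕ :=
  if ∃ h : ν.IsType k, (⟨ν, h⟩ : DiscType n k) ∈ T.discTypes C σ then 1 else 0

/-- The subset `C` of the hypersurface is an embedded normal hypersurface in the pseudo-manifold: it
is a nonempty union of normal discs, its normal coordinate solves the matching equations, and the
natural map embeds it into the pseudo-manifold. -/
structure IsEmbeddedNormalHypersurface (T : Triangulation n S) {k : ℕ}
    (C : Set (T.Hypersurface k)) : Prop where
  nonempty : C.Nonempty
  eq_union : C = ⋃ (σ : S) (ν ∈ T.discTypes C σ), T.cell σ ν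
  matching : T.MatchingEquations (T.normalCoordinate C)
  isEmbedding : Topology.IsEmbedding (C.domRestrict (Hypersurface.toSpace T k))

/-- The component `c` of the hypersurface as a subset. -/
def component (T : Triangulation n S) {k : ℕ} (c : ConnectedComponents (T.Hypersurface k)) :
    Set (T.Hypersurface k) :=
  {q | (q : ConnectedComponents (T.Hypersurface k)) = c}

end Triangulation

end

namespace Triangulation

variable {n : ℕ} {S : Type*}

/-! A projectivity records what happens to the corners of a simplex that are carried along a path of
simplices. Pairs of a point and a corner, identified by the perspectivities, form a space
`CornerSpace` over the pseudo-manifold. Where this space is a covering, its monodromy sends a loop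
in the dual graph to its projectivity, which is exactly a canonical symmetric representation.

It is a covering wherever carrying the corners around a point returns them unpermuted
(`TrivialMonodromy`, `isCoveringMapOn_forget`). Outside the `(n-3)`-skeleton only faces of
codimension at most two matter. Around a codimension-two face the labelled simplices form an orbit
of a dihedral group generated by two reflections. Arguments that look at the halfway point of a
closed word, together with the orientation, restrict the permutation with which such a word can
return. A permutation of the corners of the face itself is excluded by its sign if `n = 3` and by
`NoFolding` otherwise; an exchange of the two opposite corners would make the degree of the face odd
(`odd_degree`), against evenness.

Every path between barycentres is homotopic to a path in the dual graph (`exists_facetPath_mk_eq`).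
This gives uniqueness of the representation. It also shows that the inclusion of complements of
skeleta is surjective on fundamental groups, so that injectivity makes it an isomorphism along which
the representation is transported.

Both parts of a `(k, n-k+1)`-type have at least two elements, so every disc meets every facet. Two
discs therefore lie in the same component of the hypersurface exactly if a facet path carries one
type to the other (`coe_discProj_eq_iff`). So the discs in `σ₀` of a component form one orbit of the
induced representation, which yields the invariance and the criterion for triviality. If there are
`N` components, different discs of a simplex lie in different components. Then the natural map is
injective on each component, and compactness makes it an embedding; the matching equations hold
because the perspectivities preserve the set of discs of a component. -/

theorem perspectivity_pairing_apply (T : Triangulation n S) (τ : S × Fin (n + 1))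
    (v : Fin (n + 1)) : T.perspectivity (T.pairing τ) (T.perspectivity τ v) = v := by
  by_cases h : v = τ.2
  · rw [h, T.perspectivity_self, T.perspectivity_self, T.pairing_pairing]
  · have h' := (T.glue τ ⟨v, h⟩).2
    have h1 : T.perspectivity τ v = T.glue τ ⟨v, h⟩ := by simp [FacePairing.perspectivity, h]
    rw [h1]
    simpa [FacePairing.perspectivity, h'] using T.glue_glue τ ⟨v, h⟩

theorem perspectivity_pairing (T : Triangulation n S) (τ : S × Fin (n + 1)) :
    T.perspectivity (T.pairing τ) = (T.perspectivity τ)⁻¹ := by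
  refine eq_inv_of_mul_eq_one_left (Equiv.ext fun v => ?_)
  exact T.perspectivity_pairing_apply τ v

/-! ### Frames: simplices with a labelling of their corners -/

/-- A simplex together with a labelling of its corners. -/
abbrev Frame (_T : Triangulation n S) : Type _ := S × Equiv.Perm (Fin (n + 1))

/-- The reflection of a frame across the facet opposite to the corner with the label `v`. -/
def cross (T : Triangulation n S) (v : Fin (n + 1)) (f : T.Frame) : T.Frame :=
  ((T.pairing (f.1, f.2 v)).1, T.perspectivity (f.1, f.2 v) * f.2)

/-- Relabelling of the corners of a frame. -/
def relabel (T : Triangulation n S) (ρ : Equiv.Perm (Fin (n + 1))) (f : T.Frame) : T.Frame :=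
  (f.1, f.2 * ρ)

theorem relabel_eq_self (T : Triangulation n S) {ρ : Equiv.Perm (Fin (n + 1))} {f : T.Frame}
    (h : T.relabel ρ f = f) : ρ = 1 := by
  have := congrArg Prod.snd h
  simpa [relabel] using this

theorem relabel_one (T : Triangulation n S) (f : T.Frame) : T.relabel 1 f = f := by
  simp [relabel]

theorem relabel_relabel (T : Triangulation n S) (ρ ρ' : Equiv.Perm (Fin (n + 1))) (f : T.Frame) :
    T.relabel ρ (T.relabel ρ' f) = T.relabel (ρ' * ρ) f := by
  simp [relabel, mul_assoc]

/-- Perspectivities act on a labelling from the left and relabellings from the right, so the two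
commute except that the label naming the facet has to be translated. -/
theorem cross_relabel (T : Triangulation n S) (ρ : Equiv.Perm (Fin (n + 1))) (v : Fin (n + 1))
    (f : T.Frame) : T.cross v (T.relabel ρ f) = T.relabel ρ (T.cross (ρ v) f) := by
  simp [cross, relabel, mul_assoc]

theorem cross_snd_apply (T : Triangulation n S) (v : Fin (n + 1)) (f : T.Frame) :
    (T.cross v f).2 v = (T.pairing (f.1, f.2 v)).2 :=
  T.perspectivity_self (f.1, f.2 v)

theorem cross_cross (T : Triangulation n S) (v : Fin (n + 1)) (f : T.Frame) :
    T.cross v (T.cross v f) = f := by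
  have h : ((T.cross v f).1, (T.cross v f).2 v) = T.pairing (f.1, f.2 v) := by
    rw [cross_snd_apply]; rfl
  unfold cross at h ⊢
  rw [h, T.pairing_pairing, T.perspectivity_pairing]
  simp

/-- A frame is not mapped by a reflection to a frame of the same simplex that has the same corner
opposite to the facet. -/
theorem cross_ne_relabel (T : Triangulation n S) {v : Fin (n + 1)}
    {ρ : Equiv.Perm (Fin (n + 1))} (hρ : ρ v = v) (f : T.Frame) :
    T.cross v f ≠ T.relabel ρ f := by
  intro h
  have h1 := congrArg Prod.fst h
  have h2 : (T.cross v f).2 v = (T.relabel ρ f).2 v := by rw [h]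
  rw [cross_snd_apply] at h2
  -- The crossed facet would be paired with itself.
  refine T.pairing_ne (f.1, f.2 v) (Prod.ext h1 ?_)
  rw [h2]
  simp [relabel, hρ]

/-- The frame `g` is obtained from the frame `f` by reflections across facets opposite to corners
with labels in `Z`. -/
def Reaches (T : Triangulation n S) (Z : Set (Fin (n + 1))) : T.Frame → T.Frame → Prop :=
  Relation.ReflTransGen fun f g => ∃ v ∈ Z, g = T.cross v f

namespace Reaches

variable {T : Triangulation n S} {Z Z' : Set (Fin (n + 1))} {f g h : T.Frame}

theorem refl (f : T.Frame) : T.Reaches Z f f := Relation.ReflTransGen.refl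

theorem trans (h₁ : T.Reaches Z f g) (h₂ : T.Reaches Z g h) : T.Reaches Z f h :=
  Relation.ReflTransGen.trans h₁ h₂

theorem symm (h : T.Reaches Z f g) : T.Reaches Z g f := by
  induction h with
  | refl => exact refl _
  | tail _ h ih =>
    obtain ⟨v, hv, rfl⟩ := h
    exact Relation.ReflTransGen.head ⟨v, hv, (T.cross_cross v _).symm⟩ ih

theorem cross {v : Fin (n + 1)} (hv : v ∈ Z) (f : T.Frame) : T.Reaches Z f (T.cross v f) :=
  Relation.ReflTransGen.single ⟨v, hv, rfl⟩

theorem mono (h : T.Reaches Z f g) (hZ : Z ⊆ Z') : T.Reaches Z' f g :=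
  Relation.ReflTransGen.mono (fun _ _ ⟨v, hv, e⟩ => ⟨v, hZ hv, e⟩) _ _ h

/-- This moves the base of a reflection word to a frame with another labelling, which is what allows
words based at trivially labelled frames to be inverted and concatenated. -/
theorem relabel (h : T.Reaches Z f g) (ρ : Equiv.Perm (Fin (n + 1)))
    (hZ : ∀ v, ρ v ∈ Z → v ∈ Z') : T.Reaches Z' (T.relabel ρ f) (T.relabel ρ g) := by
  refine Relation.ReflTransGen.lift (T.relabel ρ) ?_ _ _ h
  rintro f _ ⟨v, hv, rfl⟩
  refine ⟨ρ⁻¹ v, hZ _ (by simpa using hv), ?_⟩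
  rw [cross_relabel]
  simp

end Reaches

/-! ### Identification of points by words of reflections. -/

/-- The point with permuted barycentric coordinates. -/
def permute (π : Equiv.Perm (Fin (n + 1))) (x : stdSimplex ℝ (Fin (n + 1))) :
    stdSimplex ℝ (Fin (n + 1)) :=
  ⟨fun v => x (π⁻¹ v), fun _ => x.2.1 _, (Equiv.sum_comp π⁻¹ _).trans x.2.2⟩

theorem permute_apply (π : Equiv.Perm (Fin (n + 1))) (x : stdSimplex ℝ (Fin (n + 1)))
    (v : Fin (n + 1)) : permute π x v = x (π⁻¹ v) := rfl

@[simp]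
theorem permute_apply_apply (π : Equiv.Perm (Fin (n + 1))) (x : stdSimplex ℝ (Fin (n + 1)))
    (v : Fin (n + 1)) : permute π x (π v) = x v := by
  simp [permute_apply]

theorem eq_permute_iff {π : Equiv.Perm (Fin (n + 1))} {x y : stdSimplex ℝ (Fin (n + 1))} :
    y = permute π x ↔ ∀ v, y (π v) = x v := by
  constructor
  · rintro rfl v
    simp
  · intro h
    refine Subtype.ext (funext fun v => ?_)
    have := h (π⁻¹ v)
    rw [show π (π⁻¹ v) = v from π.apply_symm_apply v] at this
    exact this

theorem permute_permute (π π' : Equiv.Perm (Fin (n + 1))) (x : stdSimplex ℝ (Fin (n + 1))) :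
    permute π (permute π' x) = permute (π * π') x :=
  rfl

theorem permute_one (x : stdSimplex ℝ (Fin (n + 1))) : permute 1 x = x := rfl

/-- The labels of the zero coordinates. -/
def zeros (x : stdSimplex ℝ (Fin (n + 1))) : Set (Fin (n + 1)) := {v | x v = 0}

theorem mem_zeros {x : stdSimplex ℝ (Fin (n + 1))} {v : Fin (n + 1)} : v ∈ zeros x ↔ x v = 0 :=
  Iff.rfl

theorem proj_permute_perspectivity (T : Triangulation n S) {σ : S} {i : Fin (n + 1)}
    {x : stdSimplex ℝ (Fin (n + 1))} (hx : x i = 0) :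
    T.proj σ x = T.proj (T.pairing (σ, i)).1 (permute (T.perspectivity (σ, i)) x) :=
  Quot.sound ⟨i, hx, rfl, fun v => permute_apply_apply _ x v⟩

/-- Points of the simplices are identified with each other if and only if they correspond to each
other under a sequence of reflections across facets that contain them. -/
theorem proj_eq_proj_iff (T : Triangulation n S) {σ σ' : S} {x x' : stdSimplex ℝ (Fin (n + 1))} :
    T.proj σ x = T.proj σ' x' ↔ ∃ π, T.Reaches (zeros x) (σ, 1) (σ', π) ∧ x' = permute π x := by
  constructor
  · intro h
    have h := Quot.eqvGen_exact h
    suffices H : ∀ p q : T.Points, Relation.EqvGen T.Identifies p q →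
        ∃ π, T.Reaches (zeros p.2) (p.1, 1) (q.1, π) ∧ q.2 = permute π p.2 from H _ _ h
    intro p q h
    induction h with
    | rel p q h =>
      obtain ⟨i, hi, h1, h2⟩ := h
      refine ⟨T.perspectivity (p.1, i), ?_, eq_permute_iff.2 h2⟩
      have := Reaches.cross (T := T) (Z := zeros p.2) hi (p.1, 1)
      simpa [Triangulation.cross, h1] using this
    | refl p => exact ⟨1, Reaches.refl _, rfl⟩
    | symm p q _ ih =>
      obtain ⟨π, h1, h2⟩ := ih
      refine ⟨π⁻¹, ?_, by rw [h2, permute_permute, inv_mul_cancel, permute_one]⟩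
      -- Relabelling by `π⁻¹` gives the start of the reversed word the trivial labelling; the labels
      -- of vanishing coordinates move along.
      have := h1.symm.relabel (Z' := zeros q.2) π⁻¹ fun v hv => by
        rw [h2, mem_zeros, permute_apply]; exact hv
      simpa [Triangulation.relabel] using this
    | trans p q r _ _ ih1 ih2 =>
      obtain ⟨π, h1, h2⟩ := ih1
      obtain ⟨π', h3, h4⟩ := ih2
      refine ⟨π' * π, h1.trans ?_, by rw [h4, h2, permute_permute]⟩
      have := h3.relabel (Z' := zeros p.2) π fun v hv => by
        rw [h2, mem_zeros, permute_apply_apply] at hv; exact hv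
      simpa [Triangulation.relabel] using this
  · rintro ⟨π, h, rfl⟩
    suffices H : ∀ g : T.Frame, T.Reaches (zeros x) (σ, 1) g →
        T.proj σ x = T.proj g.1 (permute g.2 x) from H _ h
    intro g h
    induction h with
    | refl => rfl
    | tail _ h ih =>
      obtain ⟨v, hv, rfl⟩ := h
      rw [ih, T.proj_permute_perspectivity (i := _) ((permute_apply_apply _ x v).trans hv),
        permute_permute]
      rfl

theorem suppCard_permute (π : Equiv.Perm (Fin (n + 1))) (x : stdSimplex ℝ (Fin (n + 1))) :
    suppCard (permute π x) = suppCard x := by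
  unfold suppCard
  rw [← Set.ncard_image_of_injective {v | x v ≠ 0} π.injective]
  congr 1
  ext v
  simp [permute_apply]

theorem suppCard_add_ncard_zeros (x : stdSimplex ℝ (Fin (n + 1))) :
    suppCard x + (zeros x).ncard = n + 1 := by
  have := Set.ncard_add_ncard_compl (zeros x)
  rw [Nat.card_eq_fintype_card, Fintype.card_fin] at this
  rw [add_comm]
  exact this

theorem suppCard_eq_of_proj_eq (T : Triangulation n S) {σ σ' : S}
    {x x' : stdSimplex ℝ (Fin (n + 1))} (h : T.proj σ x = T.proj σ' x') :
    suppCard x = suppCard x' := by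
  obtain ⟨π, -, rfl⟩ := T.proj_eq_proj_iff.1 h
  rw [suppCard_permute]

theorem proj_mem_skeleton_iff (T : Triangulation n S) {j : ℕ} {σ : S}
    {x : stdSimplex ℝ (Fin (n + 1))} : T.proj σ x ∈ T.skeleton j ↔ suppCard x ≤ j + 1 := by
  constructor
  · rintro ⟨σ', x', h, e⟩
    rwa [← T.suppCard_eq_of_proj_eq e]
  · exact fun h => ⟨σ, x, h, rfl⟩

end Triangulation
namespace Triangulation

variable {n : ℕ} {S : Type*}

/-! ### The dihedral group around a codimension-two face. -/

/-- The reflection across the facet with label `v` as a permutation of the frames. -/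
def crossPerm (T : Triangulation n S) (v : Fin (n + 1)) : Equiv.Perm T.Frame :=
  Function.Involutive.toPerm (T.cross v) (T.cross_cross v)

/-- Relabelling as a permutation of the frames. -/
def relabelPerm (T : Triangulation n S) (ρ : Equiv.Perm (Fin (n + 1))) : Equiv.Perm T.Frame where
  toFun := T.relabel ρ
  invFun := T.relabel ρ⁻¹
  left_inv f := by rw [relabel_relabel, mul_inv_cancel, relabel_one]
  right_inv f := by rw [relabel_relabel, inv_mul_cancel, relabel_one]

theorem crossPerm_mul_self (T : Triangulation n S) (v : Fin (n + 1)) :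
    T.crossPerm v * T.crossPerm v = 1 :=
  Equiv.ext fun f => T.cross_cross v f

theorem relabelPerm_mul_crossPerm (T : Triangulation n S) {ρ : Equiv.Perm (Fin (n + 1))}
    {v w : Fin (n + 1)} (h : ρ v = w) :
    T.relabelPerm ρ * T.crossPerm w = T.crossPerm v * T.relabelPerm ρ :=
  Equiv.ext fun f => by
    subst h
    exact (T.cross_relabel ρ v f).symm

/-- The orientation of a frame. -/
def chirality (T : Triangulation n S) (f : T.Frame) : ℤˣ :=
  T.orientation f.1 * Equiv.Perm.sign f.2

/-- This is where the orientation enters: the parity of the length of a word of reflections can be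
read off from its first and last frame. -/
theorem chirality_cross (T : Triangulation n S) (v : Fin (n + 1)) (f : T.Frame) :
    T.chirality (T.cross v f) = -T.chirality f := by
  have h := T.orientation_reversing (f.1, f.2 v)
  simp only [chirality, cross, map_mul]
  rcases Int.units_eq_one_or (T.orientation f.1) with h1 | h1 <;>
  rcases Int.units_eq_one_or (T.orientation (T.pairing (f.1, f.2 v)).1) with h2 | h2 <;>
  simp_all

theorem chirality_relabel (T : Triangulation n S) (ρ : Equiv.Perm (Fin (n + 1))) (f : T.Frame) :
    T.chirality (T.relabel ρ f) = T.chirality f * Equiv.Perm.sign ρ := by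
  simp [chirality, relabel, mul_assoc]

/-- The rotation of a frame about its codimension-two face that avoids the labels `c` and `d`. -/
def rotation (T : Triangulation n S) (c d : Fin (n + 1)) : Equiv.Perm T.Frame :=
  T.crossPerm d * T.crossPerm c

section Rotation

variable (T : Triangulation n S) {c d : Fin (n + 1)} {ρ : Equiv.Perm (Fin (n + 1))} {f : T.Frame}

theorem rotation_inv : (T.rotation c d)⁻¹ = T.crossPerm c * T.crossPerm d := by
  rw [inv_eq_iff_mul_eq_one, rotation, mul_assoc, ← mul_assoc (T.crossPerm c),
    crossPerm_mul_self, one_mul, crossPerm_mul_self]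

theorem rotation_conj_zpow {R : Equiv.Perm T.Frame}
    (h : R * T.rotation c d = (T.rotation c d)⁻¹ * R) (t : ℤ) :
    R * T.rotation c d ^ t = T.rotation c d ^ (-t) * R := by
  have : SemiconjBy R (T.rotation c d) (T.rotation c d)⁻¹ := h
  simpa using (this.zpow_right t).eq

theorem crossPerm_mul_rotation_zpow (t : ℤ) :
    T.crossPerm c * T.rotation c d ^ t = T.rotation c d ^ (-t) * T.crossPerm c := by
  refine T.rotation_conj_zpow ?_ t
  rw [rotation_inv, rotation, mul_assoc]

/-- Exchanging the labels exchanges the two reflections and hence reverses the sense of rotation. -/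
theorem relabelPerm_mul_rotation_zpow_of_swap (hc : ρ c = d) (hd : ρ d = c) (t : ℤ) :
    T.relabelPerm ρ * T.rotation c d ^ t = T.rotation c d ^ (-t) * T.relabelPerm ρ := by
  refine T.rotation_conj_zpow ?_ t
  rw [rotation_inv, rotation, ← mul_assoc, T.relabelPerm_mul_crossPerm hc, mul_assoc,
    T.relabelPerm_mul_crossPerm hd, mul_assoc]

theorem relabelPerm_mul_rotation_zpow_of_fix (hc : ρ c = c) (hd : ρ d = d) (t : ℤ) :
    T.relabelPerm ρ * T.rotation c d ^ t = T.rotation c d ^ t * T.relabelPerm ρ := by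
  have : Commute (T.relabelPerm ρ) (T.rotation c d) := by
    change T.relabelPerm ρ * (_ * _) = _ * _ * _
    rw [← mul_assoc, T.relabelPerm_mul_crossPerm hd, mul_assoc,
      T.relabelPerm_mul_crossPerm hc, mul_assoc]
  exact (this.zpow_right t).eq

/-- Two involutions generate a dihedral group, whose elements are the powers of the rotation and
their products with one reflection. -/
theorem exists_zpow_of_reaches {g : T.Frame} (h : T.Reaches {c, d} f g) :
    ∃ t : ℤ, g = (T.rotation c d ^ t) f ∨ g = (T.crossPerm c * T.rotation c d ^ t) f := by
  induction h with
  | refl => exact ⟨0, Or.inl rfl⟩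
  | tail _ h ih =>
    obtain ⟨v, hv, rfl⟩ := h
    have key : ∀ g, T.cross v g = T.crossPerm v g := fun _ => rfl
    obtain ⟨t, rfl | rfl⟩ := ih <;> rcases hv with rfl | rfl
    · exact ⟨t, Or.inr rfl⟩
    · refine ⟨t - 1, Or.inr ?_⟩
      rw [key, ← Equiv.Perm.mul_apply, sub_eq_neg_add, zpow_add, zpow_neg_one, rotation_inv,
        ← mul_assoc, ← mul_assoc, crossPerm_mul_self, one_mul]
    · refine ⟨t, Or.inl ?_⟩
      rw [key, ← Equiv.Perm.mul_apply, ← mul_assoc, crossPerm_mul_self, one_mul]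
    · refine ⟨1 + t, Or.inl ?_⟩
      rw [key, ← Equiv.Perm.mul_apply, ← mul_assoc, zpow_add, zpow_one]
      rfl

theorem reaches_rotation_zpow (t : ℤ) (f : T.Frame) :
    T.Reaches {c, d} f ((T.rotation c d ^ t) f) := by
  have h : ∀ g, T.Reaches {c, d} g (T.rotation c d g) := fun g =>
    (Reaches.cross (Or.inl rfl) g).trans (Reaches.cross (Or.inr rfl) _)
  induction t with
  | zero => exact Reaches.refl f
  | succ t ih =>
    rw [add_comm (t : ℤ) 1, zpow_add, zpow_one]
    exact ih.trans (h _)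
  | pred t ih =>
    rw [sub_eq_neg_add, zpow_add, zpow_neg_one]
    refine ih.trans (Reaches.symm ?_)
    simpa using h ((T.rotation c d)⁻¹ ((T.rotation c d ^ (-(t : ℤ))) f))

theorem chirality_rotation_zpow (t : ℤ) (f : T.Frame) :
    T.chirality ((T.rotation c d ^ t) f) = T.chirality f := by
  have h : ∀ g, T.chirality (T.rotation c d g) = T.chirality g := fun g => by
    change T.chirality (T.cross d (T.cross c g)) = _
    rw [chirality_cross, chirality_cross, neg_neg]
  induction t with
  | zero => rfl
  | succ t ih => rw [add_comm, zpow_add, zpow_one, Equiv.Perm.mul_apply, h, ih]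
  | pred t ih =>
    rw [sub_eq_neg_add, zpow_add, zpow_neg_one, Equiv.Perm.mul_apply, ← h]
    simpa using ih

/-- If equality held, the relabelling would send the frame after `s` rotations to the one after `t -
s` rotations. Halfway it would fix a frame: a rotated frame for even `t`, the reflection of one for
odd `t`. But only the trivial relabelling fixes a frame. -/
theorem rotation_zpow_ne_relabel (hcd : c ≠ d) (hc : ρ c = d) (hd : ρ d = c) (t : ℤ) :
    (T.rotation c d ^ t) f ≠ T.relabelPerm ρ f := by
  intro h
  suffices ∃ g, T.relabelPerm ρ g = g by
    obtain ⟨g, hg⟩ := this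
    have := T.relabel_eq_self hg
    subst this
    exact hcd hc
  have hs : ∀ s : ℤ, T.relabelPerm ρ ((T.rotation c d ^ s) f) = (T.rotation c d ^ (-s + t)) f := by
    intro s
    rw [← Equiv.Perm.mul_apply, T.relabelPerm_mul_rotation_zpow_of_swap hc hd,
      Equiv.Perm.mul_apply, ← h, ← Equiv.Perm.mul_apply, ← zpow_add]
  rcases Int.even_or_odd' t with ⟨s, rfl | rfl⟩
  · refine ⟨(T.rotation c d ^ s) f, ?_⟩
    rw [hs]
    congr 2
    ring
  · refine ⟨T.crossPerm c ((T.rotation c d ^ s) f), ?_⟩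
    rw [← Equiv.Perm.mul_apply, T.relabelPerm_mul_crossPerm hd, Equiv.Perm.mul_apply, hs,
      show -s + (2 * s + 1) = 1 + s by ring, zpow_add, zpow_one, rotation,
      Equiv.Perm.mul_apply, Equiv.Perm.mul_apply, ← Equiv.Perm.mul_apply, crossPerm_mul_self]
    rfl

/-- A closed word of odd length has a middle letter. If equality held, the frame next to this letter
would be carried by that reflection to a relabelling of itself that fixes the opposite corner, so a
facet would be paired with itself. The middle letter is `c` for even `t` and `d` for odd `t`. -/
theorem crossPerm_rotation_zpow_ne_relabel (hc : ρ c = c) (hd : ρ d = d) (t : ℤ) :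
    (T.crossPerm c * T.rotation c d ^ t) f ≠ T.relabelPerm ρ f := by
  intro h
  have hs : ∀ s : ℤ, T.relabelPerm ρ ((T.rotation c d ^ s) f) =
      T.crossPerm c ((T.rotation c d ^ (-s + t)) f) := by
    intro s
    have h' := T.crossPerm_mul_rotation_zpow (c := c) (d := d) (-s)
    rw [neg_neg] at h'
    rw [← Equiv.Perm.mul_apply, T.relabelPerm_mul_rotation_zpow_of_fix hc hd,
      Equiv.Perm.mul_apply, ← h, ← Equiv.Perm.mul_apply, ← mul_assoc, ← h', zpow_add, mul_assoc]
    rfl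
  rcases Int.even_or_odd' t with ⟨s, rfl | rfl⟩
  · refine T.cross_ne_relabel hc ((T.rotation c d ^ s) f) ?_
    refine Eq.trans ?_ (hs s).symm
    rw [show -s + 2 * s = s by ring]
    rfl
  · refine T.cross_ne_relabel hd ((T.rotation c d ^ (s + 1)) f) ?_
    refine Eq.trans ?_ (hs (s + 1)).symm
    rw [show -(s + 1) + (2 * s + 1) = s by ring, add_comm, zpow_add, zpow_one, rotation,
      Equiv.Perm.mul_apply, Equiv.Perm.mul_apply]
    exact T.cross_cross d _

/-- Relabelling twice gives back `f`, while following the odd word twice amounts to a rotation by an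
odd exponent. This is the source of the odd degree. -/
theorem rotation_zpow_eq_of_swap (hc : ρ c = d) (hd : ρ d = c) (hρ : ρ * ρ = 1) {t : ℤ}
    (h : (T.crossPerm c * T.rotation c d ^ t) f = T.relabelPerm ρ f) :
    (T.rotation c d ^ (2 * t + 1)) f = f := by
  have h2 : T.relabelPerm ρ (T.relabelPerm ρ f) = f := by
    change T.relabel ρ (T.relabel ρ f) = f
    rw [relabel_relabel, hρ, relabel_one]
  rw [← h, ← Equiv.Perm.mul_apply, ← mul_assoc, T.relabelPerm_mul_crossPerm hd, mul_assoc,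
    T.relabelPerm_mul_rotation_zpow_of_swap hc hd, Equiv.Perm.mul_apply, Equiv.Perm.mul_apply,
    ← h, ← Equiv.Perm.mul_apply, ← Equiv.Perm.mul_apply, ← mul_assoc, mul_assoc _ _ (T.crossPerm c),
    ← crossPerm_mul_rotation_zpow, ← mul_assoc] at h2
  rw [← rotation, mul_assoc, ← zpow_add, ← zpow_one_add] at h2
  rwa [two_mul, add_comm]

/-! ### Trivial monodromy around faces of codimension at most two -/

/-- The ordered codimension-two face of a frame whose corners have the labels in the range
of `e`. -/
def face (e : Fin (n - 1) ↪ Fin (n + 1)) (f : T.Frame) : T.OrderedFace :=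
  (f.1, e.trans f.2.toEmbedding)

theorem FaceIdentifies.symm {T : Triangulation n S} {f g : T.OrderedFace}
    (h : T.FaceIdentifies f g) : T.FaceIdentifies g f := by
  obtain ⟨i, hi, h1, h2⟩ := h
  have hp : (g.1, (T.pairing (f.1, i)).2) = T.pairing (f.1, i) := by rw [h1]
  refine ⟨(T.pairing (f.1, i)).2, ?_, ?_, fun a => ?_⟩
  · rintro ⟨a, ha⟩
    rw [h2, ← T.perspectivity_self] at ha
    exact hi ⟨a, (T.perspectivity (f.1, i)).injective ha⟩
  · rw [hp, T.pairing_pairing]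
  · rw [hp, h2, T.perspectivity_pairing_apply]

theorem faceIdentifies_face_iff {e : Fin (n - 1) ↪ Fin (n + 1)} {g : T.OrderedFace} :
    T.FaceIdentifies (T.face e f) g ↔ ∃ v ∈ (range e)ᶜ, g = T.face e (T.cross v f) := by
  constructor
  · rintro ⟨i, hi, h1, h2⟩
    refine ⟨f.2⁻¹ i, ?_, ?_⟩
    · rintro ⟨a, ha⟩
      refine hi ⟨a, ?_⟩
      change f.2 (e a) = i
      rw [ha]
      exact f.2.apply_symm_apply i
    · refine Prod.ext ?_ (DFunLike.ext _ _ fun a => ?_)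
      · rw [h1]
        simp [face, cross]
      · rw [h2]
        simp [face, cross]
  · rintro ⟨v, hv, rfl⟩
    refine ⟨f.2 v, ?_, rfl, fun a => rfl⟩
    rintro ⟨a, ha⟩
    exact hv ⟨a, f.2.injective ha⟩

/-- The gluing class of a face, which defines its degree, becomes an orbit of frames under the
reflections in the labels outside the face. -/
theorem eqvGen_face_iff {e : Fin (n - 1) ↪ Fin (n + 1)} {g : T.OrderedFace} :
    Relation.EqvGen T.FaceIdentifies (T.face e f) g ↔
      ∃ f', T.Reaches (range e)ᶜ f f' ∧ g = T.face e f' := by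
  constructor
  · intro h
    suffices H : ∀ g₁ g₂, Relation.EqvGen T.FaceIdentifies g₁ g₂ →
        ((∃ f', T.Reaches (range e)ᶜ f f' ∧ g₁ = T.face e f') ↔
          ∃ f', T.Reaches (range e)ᶜ f f' ∧ g₂ = T.face e f') from
      (H _ _ h).1 ⟨f, Reaches.refl f, rfl⟩
    have H' : ∀ g₁ g₂, T.FaceIdentifies g₁ g₂ →
        (∃ f', T.Reaches (range e)ᶜ f f' ∧ g₁ = T.face e f') →
          ∃ f', T.Reaches (range e)ᶜ f f' ∧ g₂ = T.face e f' := by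
      rintro g₁ g₂ h ⟨f', h1, rfl⟩
      obtain ⟨v, hv, rfl⟩ := T.faceIdentifies_face_iff.1 h
      exact ⟨_, h1.trans (Reaches.cross hv f'), rfl⟩
    intro g₁ g₂ h
    induction h with
    | rel g₁ g₂ h => exact ⟨H' _ _ h, H' _ _ h.symm⟩
    | refl g => exact Iff.rfl
    | symm _ _ _ ih => exact ih.symm
    | trans _ _ _ _ _ ih1 ih2 => exact ih1.trans ih2
  · rintro ⟨f', h, rfl⟩
    induction h with
    | refl => exact Relation.EqvGen.refl _
    | tail _ h ih =>
      obtain ⟨v, hv, rfl⟩ := h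
      exact ih.trans _ _ _ (.rel _ _ (T.faceIdentifies_face_iff.2 ⟨v, hv, rfl⟩))

theorem eq_one_or_eq_swap (hcd : c ≠ d) (h : ∀ v, v ≠ c → v ≠ d → ρ v = v) :
    ρ = 1 ∨ ρ = Equiv.swap c d := by
  have key : ∀ v, v ≠ c → v ≠ d → ∀ w, ρ w = v → w = v := fun v h1 h2 w hw =>
    ρ.injective (hw.trans (h v h1 h2).symm)
  have hc : ρ c = c ∨ ρ c = d := by
    by_contra! H
    exact H.1 (key _ H.1 H.2 c rfl).symm
  have hd : ρ d = c ∨ ρ d = d := by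
    by_contra! H
    exact H.2 (key _ H.1 H.2 d rfl).symm
  rcases hc with hc | hc
  · left
    refine Equiv.ext fun v => ?_
    by_cases h1 : v = c
    · rw [h1, hc]; rfl
    by_cases h2 : v = d
    · rcases hd with hd | hd
      · exact absurd (ρ.injective (hd.trans hc.symm)).symm hcd
      · rw [h2, hd]; rfl
    · exact h v h1 h2
  · right
    refine Equiv.ext fun v => ?_
    by_cases h1 : v = c
    · rw [h1, hc, Equiv.swap_apply_left]
    by_cases h2 : v = d
    · rcases hd with hd | hd
      · rw [h2, hd, Equiv.swap_apply_right]
      · exact absurd (ρ.injective (hd.trans hc.symm)).symm hcd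
    · rw [h v h1 h2, Equiv.swap_apply_of_ne_of_ne h1 h2]

/-- If a rotation about a codimension-two face closes up with the remaining two corners exchanged,
then the degree of this face is odd. -/
theorem odd_degree [Finite S] (hcd : c ≠ d) {e : Fin (n - 1) ↪ Fin (n + 1)}
    (he : (range e)ᶜ = {c, d}) {t : ℤ}
    (h : (T.crossPerm c * T.rotation c d ^ t) f = T.relabelPerm (Equiv.swap c d) f) :
    Odd (T.degree (T.face e f)) := by
  have hc : Equiv.swap c d c = d := Equiv.swap_apply_left c d
  have hd : Equiv.swap c d d = c := Equiv.swap_apply_right c d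
  have hmem : ∀ a, e a ≠ c ∧ e a ≠ d := fun a => by
    have : e a ∉ ({c, d} : Set (Fin (n + 1))) := he ▸ fun h => h ⟨a, rfl⟩
    simpa using this
  have hface : ∀ g, T.face e (T.relabelPerm (Equiv.swap c d) g) = T.face e g := fun g => by
    refine Prod.ext rfl (DFunLike.ext _ _ fun a => ?_)
    change g.2 (Equiv.swap c d (e a)) = g.2 (e a)
    rw [Equiv.swap_apply_of_ne_of_ne (hmem a).1 (hmem a).2]
  have hset : {g | Relation.EqvGen T.FaceIdentifies (T.face e f) g} =
      T.face e '' MulAction.orbit (Subgroup.zpowers (T.rotation c d)) f := by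
    ext g
    rw [mem_ofPred_eq, eqvGen_face_iff, he]
    constructor
    · rintro ⟨f', hf', rfl⟩
      obtain ⟨s, rfl | rfl⟩ := T.exists_zpow_of_reaches hf'
      · exact ⟨_, ⟨⟨_, s, rfl⟩, rfl⟩, rfl⟩
      -- Exchanging `c` and `d` does not change the face, and by `h` it brings the frames reached by
      -- odd words back into the orbit of the rotation.
      · rw [← hface, ← Equiv.Perm.mul_apply, ← mul_assoc, T.relabelPerm_mul_crossPerm hd,
          mul_assoc, T.relabelPerm_mul_rotation_zpow_of_swap hc hd, ← mul_assoc,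
          Equiv.Perm.mul_apply, ← h, ← Equiv.Perm.mul_apply, mul_assoc, ← mul_assoc (_ ^ _),
          ← crossPerm_mul_rotation_zpow, mul_assoc, ← zpow_add, ← mul_assoc, ← rotation,
          ← zpow_one_add]
        exact ⟨_, ⟨⟨_, _, rfl⟩, rfl⟩, rfl⟩
    · rintro ⟨_, ⟨⟨_, s, rfl⟩, rfl⟩, rfl⟩
      exact ⟨_, T.reaches_rotation_zpow s f, rfl⟩
  -- Frames with the same ordered face differ at most by exchanging `c` and `d`, and this exchange
  -- reverses the chirality, which rotations preserve.
  have hinj : InjOn (T.face e) (MulAction.orbit (Subgroup.zpowers (T.rotation c d)) f) := by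
    rintro _ ⟨⟨_, s, rfl⟩, rfl⟩ _ ⟨⟨_, s', rfl⟩, rfl⟩ hg
    change T.face e ((T.rotation c d ^ s) f) = T.face e ((T.rotation c d ^ s') f) at hg
    change (T.rotation c d ^ s) f = (T.rotation c d ^ s') f
    have h1 := T.chirality_rotation_zpow (c := c) (d := d) s f
    have h2 := T.chirality_rotation_zpow (c := c) (d := d) s' f
    generalize (T.rotation c d ^ s) f = g at hg h1
    generalize (T.rotation c d ^ s') f = g' at hg h2
    have hg1 : g.1 = g'.1 := congrArg (fun x : T.OrderedFace => x.1) hg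
    have hg2 : ∀ a, g.2 (e a) = g'.2 (e a) := fun a => DFunLike.congr_fun (congrArg (fun x : T.OrderedFace => x.2) hg) a
    have hg' : g' = T.relabel (g.2⁻¹ * g'.2) g := Prod.ext hg1.symm (by simp [relabel])
    have hfix : ∀ v, v ≠ c → v ≠ d → (g.2⁻¹ * g'.2) v = v := by
      intro v hvc hvd
      have hv : v ∈ range e := by
        by_contra hv
        have : v ∈ (range e)ᶜ := hv
        rw [he] at this
        simp [hvc, hvd] at this
      obtain ⟨a, rfl⟩ := hv
      rw [Equiv.Perm.mul_apply, ← hg2]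
      exact g.2.symm_apply_apply _
    rcases eq_one_or_eq_swap hcd hfix with h3 | h3
    · rw [hg', h3, relabel_one]
    · rw [hg', chirality_relabel, h3, Equiv.Perm.sign_swap hcd, h1] at h2
      simp at h2
  -- The degree is thus the period of the rotation at `f`, and it divides the odd number `2 * t +
  -- 1`.
  have hcard : T.degree (T.face e f) = Function.minimalPeriod (T.rotation c d • ·) f := by
    classical
    have := Fintype.ofFinite (MulAction.orbit (Subgroup.zpowers (T.rotation c d)) f)
    rw [MulAction.minimalPeriod_eq_card, degree, hset, hinj.ncard_image, Set.ncard_eq_toFinset_card',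
      Set.toFinset_card]
  have hper := MulAction.zpow_smul_eq_iff_minimalPeriod_dvd (a := T.rotation c d) (b := f).1
    (T.rotation_zpow_eq_of_swap hc hd (Equiv.swap_mul_self c d) h)
  rw [← hcard] at hper
  rw [← Nat.not_even_iff_odd]
  rintro ⟨m, hm⟩
  have : (2 : ℤ) ∣ 2 * t + 1 := dvd_trans ⟨m, by rw [hm]; push_cast; ring⟩ hper
  omega

/-- The stabilizer of a codimension-two face in the group generated by the two reflections that fix
it does not permute the corners of the face. -/
def RigidFaces : Prop :=
  ∀ (f : T.Frame) (c d : Fin (n + 1)) (ρ : Equiv.Perm (Fin (n + 1))), c ≠ d →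
    T.Reaches {c, d} f (T.relabel ρ f) → (ρ c = c ∧ ρ d = d ∨ ρ c = d ∧ ρ d = c) →
    ∀ v, v ≠ c → v ≠ d → ρ v = v

/-- A reflection word that returns to a relabelled frame has even length if it fixes the two labels
and odd length if it exchanges them. -/
theorem sign_of_reaches_relabel (hcd : c ≠ d) (h : T.Reaches {c, d} f (T.relabel ρ f))
    (hρ : ρ c = c ∧ ρ d = d ∨ ρ c = d ∧ ρ d = c) :
    (ρ c = c ∧ ρ d = d ∧ Equiv.Perm.sign ρ = 1) ∨
      (ρ c = d ∧ ρ d = c ∧ Equiv.Perm.sign ρ = -1 ∧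
        ∃ t : ℤ, (T.crossPerm c * T.rotation c d ^ t) f = T.relabelPerm ρ f) := by
  have h1 := T.chirality_relabel ρ f
  -- Even words cannot exchange the labels and odd words cannot fix them, by the two halfway
  -- arguments. In the remaining cases the chirality of the last frame gives the sign of `ρ`.
  obtain ⟨t, ht | ht⟩ := T.exists_zpow_of_reaches h
  · rw [ht, chirality_rotation_zpow] at h1
    rcases hρ with ⟨hc, hd⟩ | ⟨hc, hd⟩
    · exact Or.inl ⟨hc, hd, by simpa using h1.symm⟩
    · exact absurd ht.symm (T.rotation_zpow_ne_relabel hcd hc hd t)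
  · rcases hρ with ⟨hc, hd⟩ | ⟨hc, hd⟩
    · exact absurd ht.symm (T.crossPerm_rotation_zpow_ne_relabel hc hd t)
    · refine Or.inr ⟨hc, hd, ?_, t, ht.symm⟩
      rw [ht, Equiv.Perm.mul_apply] at h1
      have h2 := T.chirality_cross c ((T.rotation c d ^ t) f)
      change T.chirality (T.cross c ((T.rotation c d ^ t) f)) = _ at h1
      rw [h2, chirality_rotation_zpow] at h1
      have : T.chirality f * -1 = T.chirality f * Equiv.Perm.sign ρ := by simpa using h1
      exact (mul_left_cancel this).symm

/-- Only two corners are left to be moved, and exchanging them would be odd. -/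
theorem eq_one_of_sign_eq_one {ρ : Equiv.Perm (Fin 4)} {c d : Fin 4} (hcd : c ≠ d) (hc : ρ c = c)
    (hd : ρ d = d) (h : Equiv.Perm.sign ρ = 1) : ρ = 1 := by
  have hsub : ρ.support ⊆ {c, d}ᶜ := by
    intro v hv
    rw [Equiv.Perm.mem_support] at hv
    simp only [Finset.mem_compl, Finset.mem_insert, Finset.mem_singleton]
    rintro (rfl | rfl) <;> contradiction
  have hcard := Finset.card_le_card hsub
  rw [Finset.card_compl, Finset.card_pair hcd, Fintype.card_fin] at hcard
  rcases hcard.lt_or_eq with h' | h'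
  · exact Equiv.Perm.card_support_le_one.1 (by omega)
  · have := (Equiv.Perm.card_support_eq_two.1 h').sign_eq
    rw [h] at this
    exact absurd this (by decide)

/-- In dimension three the orientation alone prevents an edge from being flipped: the sign of `ρ` is
known from its effect on `c` and `d`, and it determines the effect on the two ends of the edge. -/
theorem rigidFaces_of_eq_three (hn : n = 3) : T.RigidFaces := by
  subst hn
  intro f c d ρ hcd h hρ v hvc hvd
  rcases T.sign_of_reaches_relabel hcd h hρ with ⟨hc, hd, hs⟩ | ⟨hc, hd, hs, -⟩
  · rw [eq_one_of_sign_eq_one hcd hc hd hs]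
    rfl
  · have : Equiv.swap c d * ρ = 1 := by
      refine eq_one_of_sign_eq_one hcd ?_ ?_ ?_
      · simp [hc]
      · simp [hd]
      · rw [map_mul, hs, Equiv.Perm.sign_swap hcd]
        rfl
    rw [← Equiv.swap_mul_self_mul c d ρ, this, mul_one, Equiv.swap_apply_of_ne_of_ne hvc hvd]

theorem exists_embedding_range_compl (hcd : c ≠ d) :
    ∃ e : Fin (n - 1) ↪ Fin (n + 1), (range e)ᶜ = {c, d} := by
  have hcard : ({c, d}ᶜ : Finset (Fin (n + 1))).card = n - 1 := by
    rw [Finset.card_compl, Finset.card_pair hcd, Fintype.card_fin]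
    omega
  refine ⟨(Finset.orderEmbOfFin _ hcard).toEmbedding, ?_⟩
  have := Finset.range_orderEmbOfFin _ hcard
  change (range (Finset.orderEmbOfFin _ hcard))ᶜ = _
  rw [this, Finset.coe_compl, compl_compl]
  simp

/-- As `ρ` preserves the pair `c`, `d`, a word that returns to the frame relabelled by `ρ`
identifies the face with itself, with its corners permuted by `ρ`. -/
theorem rigidFaces_of_noFolding (hT : T.NoFolding) : T.RigidFaces := by
  intro f c d ρ hcd h hρ v hvc hvd
  obtain ⟨e, he⟩ := exists_embedding_range_compl hcd
  have hrange : ∀ w, w ∈ range e ↔ w ≠ c ∧ w ≠ d := fun w => by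
    rw [← compl_compl (range e), he]
    simp
  have hw : ∀ w, ρ w ∈ range e ↔ w ∈ range e := fun w => by
    rw [hrange, hrange]
    rcases hρ with ⟨hc, hd⟩ | ⟨hc, hd⟩
    · rw [← ρ.injective.ne_iff (x := w) (y := c), ← ρ.injective.ne_iff (x := w) (y := d), hc, hd]
    · rw [← ρ.injective.ne_iff (x := w) (y := c), ← ρ.injective.ne_iff (x := w) (y := d), hc, hd,
        and_comm]
  have h1 := T.eqvGen_face_iff (f := f) (e := e) (g := T.face e (T.relabel ρ f)) |>.2
    ⟨_, he ▸ h, rfl⟩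
  have h2 := hT f.1 _ _ h1 (by
    ext u
    constructor
    · rintro ⟨a, rfl⟩
      obtain ⟨b, hb⟩ := (hw (ρ⁻¹ (e a))).1 ⟨a, (ρ.apply_symm_apply _).symm⟩
      refine ⟨b, ?_⟩
      change f.2 (ρ (e b)) = f.2 (e a)
      rw [hb]
      exact congrArg f.2 (ρ.apply_symm_apply _)
    · rintro ⟨a, rfl⟩
      obtain ⟨b, hb⟩ := (hw (e a)).2 ⟨a, rfl⟩
      refine ⟨b, ?_⟩
      change f.2 (e b) = f.2 (ρ (e a))
      rw [hb])
  obtain ⟨a, rfl⟩ := (hrange v).2 ⟨hvc, hvd⟩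
  exact (f.2.injective (DFunLike.congr_fun h2 a)).symm

/-- In an even triangulation with rigid faces the monodromy around faces of codimension at most two
is trivial. -/
theorem eq_one_of_reaches_relabel [Finite S] (hT : T.IsEven) (hR : T.RigidFaces)
    {Z : Set (Fin (n + 1))} (hZ : Z.ncard ≤ 2) (hρ : ∀ v, ρ v ∈ Z ↔ v ∈ Z)
    (h : T.Reaches Z f (T.relabel ρ f)) : ρ = 1 := by
  rcases Nat.lt_or_eq_of_le hZ with hZ | hZ
  -- With at most one label available, a single involution acts, so at most two frames are reached.
  · have hf : T.Reaches Z f (T.relabel ρ f) →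
        T.relabel ρ f = f ∨ ∃ v ∈ Z, T.relabel ρ f = T.cross v f := by
      generalize T.relabel ρ f = g
      intro h
      induction h with
      | refl => exact Or.inl rfl
      | tail _ h ih =>
        obtain ⟨v, hv, rfl⟩ := h
        rcases ih with rfl | ⟨w, hw, rfl⟩
        · exact Or.inr ⟨v, hv, rfl⟩
        · obtain rfl : v = w := (Set.ncard_le_one_iff (Set.toFinite Z)).1 (by omega) hv hw
          exact Or.inl (T.cross_cross v f)
    rcases hf h with h | ⟨v, hv, h⟩
    · exact T.relabel_eq_self h
    · have : ρ v = v := (Set.ncard_le_one_iff (Set.toFinite Z)).1 (by omega) ((hρ v).2 hv) hv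
      exact absurd h.symm (T.cross_ne_relabel this f)
  · obtain ⟨c, d, hcd, rfl⟩ := Set.ncard_eq_two.1 hZ
    have hρ' : ρ c = c ∧ ρ d = d ∨ ρ c = d ∧ ρ d = c := by
      have hc := (hρ c).2 (Or.inl rfl)
      have hd := (hρ d).2 (Or.inr rfl)
      have hne := ρ.injective.ne hcd
      rcases hc with hc | hc <;> rcases hd with hd | hd
      · exact absurd (hc.trans hd.symm) hne
      · exact Or.inl ⟨hc, hd⟩
      · exact Or.inr ⟨hc, hd⟩
      · exact absurd (hc.trans hd.symm) hne
    have hfix := hR f c d ρ hcd h hρ'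
    rcases T.sign_of_reaches_relabel hcd h hρ' with ⟨hc, hd, hs⟩ | ⟨hc, hd, hs, t, ht⟩
    · rcases eq_one_or_eq_swap hcd hfix with h1 | h1
      · exact h1
      · rw [h1, Equiv.swap_apply_left] at hc
        exact absurd hc.symm hcd
    · rcases eq_one_or_eq_swap hcd hfix with h1 | h1
      · exact h1
      -- Only the exchange of `c` and `d` is left. This is the one place where evenness is used.
      · obtain ⟨e, he⟩ := exists_embedding_range_compl hcd
        rw [h1] at ht
        have := T.odd_degree hcd he ht
        exact absurd (hT _) (Nat.not_even_iff_odd.2 this)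

end Rotation

end Triangulation
namespace Triangulation

variable {n : ℕ} {S : Type*}

/-! ### Conical neighbourhoods -/

theorem abs_sub_le_dist (x y : stdSimplex ℝ (Fin (n + 1))) (v : Fin (n + 1)) :
    |x v - y v| ≤ dist x y :=
  dist_le_pi_dist (x : Fin (n + 1) → ℝ) y v

theorem dist_permute (π : Equiv.Perm (Fin (n + 1))) (x y : stdSimplex ℝ (Fin (n + 1))) :
    dist (permute π x) (permute π y) = dist x y := by
  have key : ∀ (π : Equiv.Perm (Fin (n + 1))) (x y : stdSimplex ℝ (Fin (n + 1))),
      dist (permute π x) (permute π y) ≤ dist x y := fun π x y =>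
    (dist_pi_le_iff dist_nonneg).2 fun v => abs_sub_le_dist x y (π⁻¹ v)
  refine le_antisymm (key π x y) ?_
  have := key π⁻¹ (permute π x) (permute π y)
  rwa [permute_permute, permute_permute, inv_mul_cancel, permute_one, permute_one] at this

/-- The point that divides the segment from `x` to `y` in the ratio `t : 1 - t`. -/
def lineTo (x y : stdSimplex ℝ (Fin (n + 1))) (t : unitInterval) : stdSimplex ℝ (Fin (n + 1)) :=
  ⟨fun v => (1 - (t : ℝ)) * x v + t * y v,
    convex_stdSimplex ℝ _ x.2 y.2 (sub_nonneg.2 t.2.2) t.2.1 (by ring)⟩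

theorem lineTo_apply (x y : stdSimplex ℝ (Fin (n + 1))) (t : unitInterval) (v : Fin (n + 1)) :
    lineTo x y t v = (1 - (t : ℝ)) * x v + t * y v := rfl

@[simp]
theorem lineTo_zero (x y : stdSimplex ℝ (Fin (n + 1))) : lineTo x y 0 = x :=
  Subtype.ext (funext fun v => (lineTo_apply x y 0 v).trans (by simp; rfl))

@[simp]
theorem lineTo_one (x y : stdSimplex ℝ (Fin (n + 1))) : lineTo x y 1 = y :=
  Subtype.ext (funext fun v => (lineTo_apply x y 1 v).trans (by simp; rfl))

@[simp]
theorem lineTo_self (x : stdSimplex ℝ (Fin (n + 1))) (t : unitInterval) : lineTo x x t = x :=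
  Subtype.ext (funext fun v => (lineTo_apply x x t v).trans (by ring_nf; rfl))

theorem permute_lineTo (π : Equiv.Perm (Fin (n + 1))) (x y : stdSimplex ℝ (Fin (n + 1)))
    (t : unitInterval) : permute π (lineTo x y t) = lineTo (permute π x) (permute π y) t := rfl

theorem continuous_lineTo :
    Continuous fun p : (stdSimplex ℝ (Fin (n + 1)) × stdSimplex ℝ (Fin (n + 1))) × unitInterval =>
      lineTo p.1.1 p.1.2 p.2 := by
  unfold lineTo
  refine Continuous.subtype_mk (continuous_pi fun v => ?_) _
  have h1 : Continuous fun p : (stdSimplex ℝ (Fin (n + 1)) × stdSimplex ℝ (Fin (n + 1))) ×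
      unitInterval => p.1.1 v :=
    (continuous_apply v).comp (continuous_subtype_val.comp (continuous_fst.comp continuous_fst))
  have h2 : Continuous fun p : (stdSimplex ℝ (Fin (n + 1)) × stdSimplex ℝ (Fin (n + 1))) ×
      unitInterval => p.1.2 v :=
    (continuous_apply v).comp (continuous_subtype_val.comp (continuous_snd.comp continuous_fst))
  fun_prop

theorem zeros_subset_lineTo {x y : stdSimplex ℝ (Fin (n + 1))} (t : unitInterval) :
    zeros x ∩ zeros y ⊆ zeros (lineTo x y t) := by
  rintro v ⟨h1, h2⟩
  rw [mem_zeros] at *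
  rw [lineTo_apply, h1, h2]
  ring

/-- For `t > 0` the support contains that of `y`, and for `t = 0` the point is `x`. This keeps all
straight homotopies outside the skeleton. -/
theorem lt_suppCard_lineTo {m : ℕ} {x y : stdSimplex ℝ (Fin (n + 1))} (hx : m < suppCard x)
    (hy : m < suppCard y) (t : unitInterval) : m < suppCard (lineTo x y t) := by
  rcases eq_or_lt_of_le t.2.1 with h | h
  · obtain rfl : t = 0 := Subtype.ext h.symm
    simpa using hx
  · refine hy.trans_le (Set.ncard_le_ncard (fun v hv => ?_) (Set.toFinite _))
    have h0 : 0 ≤ 1 - (t : ℝ) := sub_nonneg.2 t.2.2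
    have h1 : 0 ≤ x v := x.2.1 v
    have h2 : 0 < y v := lt_of_le_of_ne (y.2.1 v) (Ne.symm hv)
    change (1 - (t : ℝ)) * x v + t * y v ≠ 0
    positivity

theorem finite_lifts [Finite S] (T : Triangulation n S) (q : T.Space) :
    {p : T.Points | T.proj p.1 p.2 = q}.Finite := by
  obtain ⟨⟨σ, x⟩, rfl⟩ := Quot.exists_rep q
  refine (Set.finite_range fun f : T.Frame => (⟨f.1, permute f.2 x⟩ : T.Points)).subset ?_
  rintro ⟨σ', x'⟩ h
  obtain ⟨π, -, rfl⟩ := T.proj_eq_proj_iff.1 h.symm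
  exact ⟨(σ', π), rfl⟩

theorem exists_pos_forall_lt {F : Set ℝ} (hF : F.Finite) : ∃ ε > 0, ∀ r ∈ F, r < ε → r ≤ 0 := by
  induction F, hF using Set.Finite.induction_on with
  | empty => exact ⟨1, one_pos, by simp⟩
  | @insert a F _ _ ih =>
    obtain ⟨ε, hε, h⟩ := ih
    by_cases ha : 0 < a
    · refine ⟨min ε a, lt_min hε ha, ?_⟩
      rintro r (rfl | hr) hlt
      · exact absurd (hlt.trans_le (min_le_right _ _)) (lt_irrefl _)
      · exact h r hr (hlt.trans_le (min_le_left _ _))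
    · refine ⟨ε, hε, ?_⟩
      rintro r (rfl | hr) hlt
      · exact not_lt.1 ha
      · exact h r hr hlt

/-- The balls of radius `ε` around the preimages of `q` are disjoint and meet only the facets that
contain their centres. -/
structure IsRadius (T : Triangulation n S) (q : T.Space) (ε : ℝ) : Prop where
  eq_of_dist_lt : ∀ {σ x x'}, T.proj σ x = q → T.proj σ x' = q → dist x x' < 2 * ε → x = x'
  eq_zero_of_lt : ∀ {σ x v}, T.proj σ x = q → x v < ε → x v = 0

/-- A point has finitely many lifts, so the positive distances between lifts have a positive lower
bound. The case `q = q'` gives radii; the general case gives the Hausdorff property. -/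
theorem exists_dist_bound [Finite S] (T : Triangulation n S) (q q' : T.Space) :
    ∃ ε > 0, ∀ {σ x x'}, T.proj σ x = q → T.proj σ x' = q' → dist x x' < 2 * ε → x = x' := by
  classical
  have h1 : {r : ℝ | ∃ p p' : T.Points, T.proj p.1 p.2 = q ∧ T.proj p'.1 p'.2 = q' ∧
      r = dist p.2 p'.2}.Finite := by
    refine (((T.finite_lifts q).prod (T.finite_lifts q')).image
      fun p => dist p.1.2 p.2.2).subset ?_
    rintro _ ⟨p, p', h, h', rfl⟩
    exact ⟨(p, p'), ⟨h, h'⟩, rfl⟩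
  obtain ⟨ε, hε, h⟩ := exists_pos_forall_lt h1
  refine ⟨ε / 2, half_pos hε, fun {σ x x'} hx hx' hd => ?_⟩
  have := h _ ⟨⟨σ, x⟩, ⟨σ, x'⟩, hx, hx', rfl⟩ (by dsimp only; linarith)
  exact dist_le_zero.1 this

theorem exists_isRadius [Finite S] (T : Triangulation n S) (q : T.Space) :
    ∃ ε > 0, T.IsRadius q ε := by
  obtain ⟨ε, hε, h⟩ := T.exists_dist_bound q q
  have h2 : {r : ℝ | ∃ (p : T.Points) (v : Fin (n + 1)), T.proj p.1 p.2 = q ∧ r = p.2 v}.Finite := by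
    refine (((T.finite_lifts q).prod (Set.finite_univ (α := Fin (n + 1)))).image
      fun p => p.1.2 p.2).subset ?_
    rintro _ ⟨p, v, h, rfl⟩
    exact ⟨(p, v), ⟨h, trivial⟩, rfl⟩
  obtain ⟨ε', hε', h'⟩ := exists_pos_forall_lt h2
  refine ⟨min ε ε', lt_min hε hε', fun {σ x x'} hx hx' hd => ?_, fun {σ x v} hx hv => ?_⟩
  · exact h hx hx' (hd.trans_le (by linarith [min_le_left ε ε']))
  · exact le_antisymm (h' _ ⟨⟨σ, x⟩, v, hx, rfl⟩ (hv.trans_le (min_le_right _ _))) (x.2.1 v)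

theorem IsRadius.mono {T : Triangulation n S} {q : T.Space} {ε ε' : ℝ} (h : T.IsRadius q ε)
    (hle : ε' ≤ ε) : T.IsRadius q ε' :=
  ⟨fun hx hx' hd => h.eq_of_dist_lt hx hx' (by linarith),
    fun hx hv => h.eq_zero_of_lt hx (hv.trans_le hle)⟩

/-- Every facet through `y` also contains the centre `x`, so a gluing that applies to `y` applies to
the whole segment between them. -/
theorem IsRadius.zeros_subset {T : Triangulation n S} {q : T.Space} {ε : ℝ} (h : T.IsRadius q ε)
    {σ : S} {x y : stdSimplex ℝ (Fin (n + 1))} (hx : T.proj σ x = q) (hxy : dist y x < ε) :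
    zeros y ⊆ zeros x := by
  intro v hv
  rw [mem_zeros] at hv ⊢
  have h1 := abs_sub_le_dist y x v
  rw [hv, zero_sub, abs_neg] at h1
  exact h.eq_zero_of_lt hx ((le_abs_self _).trans_lt (h1.trans_lt hxy))

theorem IsRadius.exists_of_proj_eq {T : Triangulation n S} {q : T.Space} {ε : ℝ}
    (h : T.IsRadius q ε) {σ σ' : S} {x y y' : stdSimplex ℝ (Fin (n + 1))} (hx : T.proj σ x = q)
    (hxy : dist y x < ε) (hy : T.proj σ y = T.proj σ' y') :
    ∃ π, T.Reaches (zeros y) (σ, 1) (σ', π) ∧ y' = permute π y ∧ T.proj σ' (permute π x) = q ∧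
      dist y' (permute π x) < ε := by
  obtain ⟨π, hπ, rfl⟩ := T.proj_eq_proj_iff.1 hy
  refine ⟨π, hπ, rfl, ?_, by rwa [dist_permute]⟩
  rw [← hx, eq_comm, proj_eq_proj_iff]
  exact ⟨π, hπ.mono (h.zeros_subset hx hxy), rfl⟩

/-- The image of the balls of radius `ε` around the preimages of `q`. -/
def star (T : Triangulation n S) (q : T.Space) (ε : ℝ) : Set T.Space :=
  {u | ∃ σ y x, T.proj σ y = u ∧ T.proj σ x = q ∧ dist y x < ε}

theorem mem_star_self (T : Triangulation n S) (q : T.Space) {ε : ℝ} (hε : 0 < ε) :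
    q ∈ T.star q ε := by
  obtain ⟨⟨σ, x⟩, rfl⟩ := Quot.exists_rep q
  exact ⟨σ, x, x, rfl, rfl, by rwa [dist_self]⟩

theorem IsRadius.proj_mem_star_iff {T : Triangulation n S} {q : T.Space} {ε : ℝ}
    (h : T.IsRadius q ε) {σ : S} {y : stdSimplex ℝ (Fin (n + 1))} :
    T.proj σ y ∈ T.star q ε ↔ ∃ x, T.proj σ x = q ∧ dist y x < ε := by
  constructor
  · rintro ⟨σ', y', x', h1, h2, h3⟩
    obtain ⟨π, -, -, h4, h5⟩ := h.exists_of_proj_eq h2 h3 h1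
    exact ⟨_, h4, h5⟩
  · rintro ⟨x, h1, h2⟩
    exact ⟨σ, y, x, rfl, h1, h2⟩

theorem IsRadius.isOpen_star {T : Triangulation n S} {q : T.Space} {ε : ℝ}
    (h : T.IsRadius q ε) : IsOpen (T.star q ε) := by
  rw [← isQuotientMap_quot_mk.isOpen_preimage, isOpen_sigma_iff]
  intro σ
  have : Sigma.mk σ ⁻¹' (Quot.mk T.Identifies ⁻¹' T.star q ε) =
      ⋃ x ∈ {x | T.proj σ x = q}, Metric.ball x ε := by
    ext y
    simp only [mem_preimage, mem_iUnion, Metric.mem_ball]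
    refine h.proj_mem_star_iff.trans ?_
    simp
  rw [this]
  exact isOpen_biUnion fun x _ => Metric.isOpen_ball

/-- A point in two small stars would have a lift close to lifts of both centres. The Hausdorff
property is needed to recognize embeddings of compact components. -/
theorem t2Space [Finite S] (T : Triangulation n S) : T2Space T.Space := by
  refine ⟨fun q q' hne => ?_⟩
  obtain ⟨ε₁, h₁, H₁⟩ := T.exists_isRadius q
  obtain ⟨ε₂, h₂, H₂⟩ := T.exists_isRadius q'
  obtain ⟨ε₃, h₃, H₃⟩ := T.exists_dist_bound q q'
  have hε : 0 < min (min ε₁ ε₂) ε₃ := lt_min (lt_min h₁ h₂) h₃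
  generalize he : min (min ε₁ ε₂) ε₃ = ε at hε
  have he1 : ε ≤ ε₁ := he ▸ (min_le_left _ _).trans (min_le_left _ _)
  have he2 : ε ≤ ε₂ := he ▸ (min_le_left _ _).trans (min_le_right _ _)
  have he3 : ε ≤ ε₃ := he ▸ min_le_right _ _
  have H₁ := H₁.mono he1
  have H₂ := H₂.mono he2
  refine ⟨_, _, H₁.isOpen_star, H₂.isOpen_star, T.mem_star_self q hε, T.mem_star_self q' hε, ?_⟩
  rw [Set.disjoint_left]
  intro u hu hu'
  obtain ⟨⟨σ, y⟩, rfl⟩ := Quot.exists_rep u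
  obtain ⟨x, hx, hxy⟩ := H₁.proj_mem_star_iff.1 hu
  obtain ⟨x', hx', hxy'⟩ := H₂.proj_mem_star_iff.1 hu'
  have hd := dist_triangle_left x x' y
  have := H₃ hx hx' (by linarith)
  subst this
  exact hne (hx.symm.trans hx')

open Classical in
/-- The centre of the ball that contains a point in the preimage of a star. -/
noncomputable def apex (T : Triangulation n S) (q : T.Space) (ε : ℝ) (σ : S) (y : stdSimplex ℝ (Fin (n + 1))) :
    stdSimplex ℝ (Fin (n + 1)) :=
  if h : ∃ x, T.proj σ x = q ∧ dist y x < ε then h.choose else y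

theorem IsRadius.apex_eq {T : Triangulation n S} {q : T.Space} {ε : ℝ}
    (h : T.IsRadius q ε) {σ : S} {x y : stdSimplex ℝ (Fin (n + 1))} (hx : T.proj σ x = q)
    (hxy : dist y x < ε) : T.apex q ε σ y = x := by
  have hex : ∃ x, T.proj σ x = q ∧ dist y x < ε := ⟨x, hx, hxy⟩
  rw [apex, dif_pos hex]
  have hd := dist_triangle_left hex.choose x y
  exact h.eq_of_dist_lt hex.choose_spec.1 hx (by linarith [hex.choose_spec.2])

/-- Stars are contractible along segments. -/
theorem IsRadius.exists_contraction {T : Triangulation n S} {q : T.Space} {ε : ℝ}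
    (h : T.IsRadius q ε) : ∃ H : T.star q ε × unitInterval → T.Space, Continuous H ∧
      ∀ (u : T.star q ε) (σ : S) (y : stdSimplex ℝ (Fin (n + 1))), T.proj σ y = u →
        ∃ x, T.proj σ x = q ∧ dist y x < ε ∧ ∀ t, H (u, t) = T.proj σ (lineTo y x t) := by
  -- The contraction is defined through chosen lifts; `hH` shows that every lift gives the same
  -- result.
  let H : T.star q ε × unitInterval → T.Space := fun p =>
    T.proj (Quot.out p.1.1).1
      (lineTo (Quot.out p.1.1).2 (T.apex q ε (Quot.out p.1.1).1 (Quot.out p.1.1).2) p.2)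
  have hH : ∀ (u : T.star q ε) (σ : S) (y : stdSimplex ℝ (Fin (n + 1))), T.proj σ y = u →
      ∃ x, T.proj σ x = q ∧ dist y x < ε ∧ ∀ t, H (u, t) = T.proj σ (lineTo y x t) := by
    intro u σ y hy
    have hu := u.2
    obtain ⟨p, hp⟩ : ∃ p, Quot.out u.1 = p := ⟨_, rfl⟩
    obtain ⟨σ', y'⟩ := p
    have hy' : T.proj σ' y' = u := by
      rw [← Quot.out_eq u.1, hp]
    rw [← hy] at hu
    obtain ⟨x, hx, hxy⟩ := h.proj_mem_star_iff.1 hu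
    refine ⟨x, hx, hxy, fun t => ?_⟩
    obtain ⟨π, h1, h2, h3, h4⟩ := h.exists_of_proj_eq hx hxy (hy.trans hy'.symm)
    change T.proj (Quot.out u.1).1
      (lineTo (Quot.out u.1).2 (T.apex q ε (Quot.out u.1).1 (Quot.out u.1).2) t) = _
    rw [hp]
    dsimp only
    rw [h.apex_eq h3 h4, eq_comm, proj_eq_proj_iff]
    refine ⟨π, h1.mono fun v hv => zeros_subset_lineTo t ⟨hv, h.zeros_subset hx hxy hv⟩, ?_⟩
    rw [h2, permute_lineTo]
  refine ⟨H, ?_, hH⟩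
  -- The product of this quotient map with the locally compact interval is again a quotient map, so
  -- continuity can be tested on the simplices, where the centre is locally constant.
  have hq := (isQuotientMap_quot_mk (r := T.Identifies)).restrictPreimage_isOpen h.isOpen_star
  refine hq.continuous_lift_prod_left ?_
  rw [continuous_iff_continuousAt]
  rintro ⟨⟨⟨σ, y⟩, hu⟩, t⟩
  obtain ⟨x, hx, hxy⟩ := h.proj_mem_star_iff.1 hu
  have hopen : IsOpen {p : (Quot.mk T.Identifies ⁻¹' T.star q ε) × unitInterval |
      p.1.1 ∈ Sigma.mk σ '' Metric.ball x ε} :=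
    (isOpenMap_sigmaMk (σ := fun _ : S => stdSimplex ℝ (Fin (n + 1))) (i := σ) _
      Metric.isOpen_ball).preimage (continuous_subtype_val.comp continuous_fst)
  let y' : T.Points → stdSimplex ℝ (Fin (n + 1)) := fun p => p.2
  have hy' : Continuous y' := continuous_sigma fun _ => continuous_id
  have hcont : Continuous fun p : (Quot.mk T.Identifies ⁻¹' T.star q ε) × unitInterval =>
      T.proj σ (lineTo (y' p.1.1) x p.2) := by
    refine (continuous_quot_mk.comp (continuous_sigmaMk
      (σ := fun _ : S => stdSimplex ℝ (Fin (n + 1))))).comp (continuous_lineTo.comp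
        (f := fun p : (Quot.mk T.Identifies ⁻¹' T.star q ε) × unitInterval =>
          ((y' p.1.1, x), p.2)) ?_)
    exact ((hy'.comp (continuous_subtype_val.comp continuous_fst)).prodMk
      continuous_const).prodMk continuous_snd
  refine hcont.continuousAt.congr ?_
  filter_upwards [hopen.mem_nhds (show _ from ⟨y, hxy, rfl⟩)]
  rintro ⟨⟨_, hu'⟩, t'⟩ ⟨z, hz, rfl⟩
  obtain ⟨x', hx', hzx', h'⟩ := hH ⟨T.proj σ z, hu'⟩ σ z rfl
  have : x = x' := by
    rw [← h.apex_eq hx' hzx', h.apex_eq hx hz]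
  subst this
  exact (h' t').symm

end Triangulation
namespace Triangulation

variable {n : ℕ} {S : Type*}

/-! ### Homotopies inside simplices -/

/-- The path `L` is the image of a path from `x` to `y` in the simplex `σ`. -/
def LiesIn (T : Triangulation n S) {j : ℕ} {a b : T.Complement j} (L : Path a b) (σ : S)
    (x y : stdSimplex ℝ (Fin (n + 1))) : Prop :=
  ∃ ℓ : Path x y, ∀ s, (L s).1 = T.proj σ (ℓ s)

theorem continuous_proj (T : Triangulation n S) (σ : S) : Continuous (T.proj σ) :=
  continuous_quot_mk.comp (continuous_sigmaMk (σ := fun _ : S => stdSimplex ℝ (Fin (n + 1))))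

section LiesIn

variable {T : Triangulation n S} {j : ℕ} {a b c : T.Complement j} {σ : S}
  {x y z : stdSimplex ℝ (Fin (n + 1))}

theorem lt_suppCard_of_proj_eq (h : T.proj σ x = a.1) : j + 1 < suppCard x := by
  have h1 := a.2
  rw [← h, proj_mem_skeleton_iff] at h1
  exact not_le.1 h1

theorem LiesIn.left {L : Path a b} (h : T.LiesIn L σ x y) : T.proj σ x = a.1 := by
  obtain ⟨ℓ, h⟩ := h
  have := h 0
  rw [L.source, ℓ.source] at this
  exact this.symm

theorem LiesIn.right {L : Path a b} (h : T.LiesIn L σ x y) : T.proj σ y = b.1 := by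
  obtain ⟨ℓ, h⟩ := h
  have := h 1
  rw [L.target, ℓ.target] at this
  exact this.symm

theorem LiesIn.symm {L : Path a b} (h : T.LiesIn L σ x y) : T.LiesIn L.symm σ y x := by
  obtain ⟨ℓ, h⟩ := h
  exact ⟨ℓ.symm, fun s => h _⟩

theorem LiesIn.trans {L : Path a b} {L' : Path b c} (h : T.LiesIn L σ x y)
    (h' : T.LiesIn L' σ y z) : T.LiesIn (L.trans L') σ x z := by
  obtain ⟨ℓ, h⟩ := h
  obtain ⟨ℓ', h'⟩ := h'
  refine ⟨ℓ.trans ℓ', fun s => ?_⟩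
  rw [Path.trans_apply, Path.trans_apply]
  split_ifs
  · exact h _
  · exact h' _

/-- The straight-line homotopy between lifts with common endpoints works, since segments between
points outside the skeleton stay outside it. -/
theorem LiesIn.mk_eq_mk {L L' : Path a b} (h : T.LiesIn L σ x y) (h' : T.LiesIn L' σ x y) :
    Path.Homotopic.Quotient.mk L = Path.Homotopic.Quotient.mk L' := by
  obtain ⟨ℓ, h⟩ := h
  obtain ⟨ℓ', h'⟩ := h'
  rw [Path.Homotopic.Quotient.eq]
  refine ⟨⟨⟨⟨fun p => ⟨T.proj σ (lineTo (ℓ p.2) (ℓ' p.2) p.1), ?_⟩, ?_⟩, ?_, ?_⟩, ?_⟩⟩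
  · rw [proj_mem_skeleton_iff, not_le]
    exact lt_suppCard_lineTo (lt_suppCard_of_proj_eq (h p.2).symm)
      (lt_suppCard_of_proj_eq (h' p.2).symm) p.1
  · refine Continuous.subtype_mk ((T.continuous_proj σ).comp (continuous_lineTo.comp
      (f := fun p : unitInterval × unitInterval => ((ℓ p.2, ℓ' p.2), p.1)) ?_)) _
    fun_prop
  · intro s
    refine Subtype.ext ?_
    change T.proj σ (lineTo (ℓ s) (ℓ' s) 0) = (L s).1
    rw [lineTo_zero, h]
  · intro s
    refine Subtype.ext ?_
    change T.proj σ (lineTo (ℓ s) (ℓ' s) 1) = (L' s).1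
    rw [lineTo_one, h']
  · intro t s hs
    refine Subtype.ext ?_
    change T.proj σ (lineTo (ℓ s) (ℓ' s) t) = (L s).1
    rw [h]
    rcases hs with rfl | rfl
    · rw [ℓ.source, ℓ'.source, lineTo_self]
    · rw [ℓ.target, ℓ'.target, lineTo_self]

/-- The segment from `x` to `y`. -/
def linePath (x y : stdSimplex ℝ (Fin (n + 1))) : Path x y where
  toFun := lineTo x y
  continuous_toFun := continuous_lineTo.comp
    (continuous_const.prodMk continuous_id : Continuous fun t : unitInterval => ((x, y), t))
  source' := lineTo_zero x y
  target' := lineTo_one x y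

/-- Two points in the image of a simplex are joined by the image of the segment between lifts. -/
theorem exists_liesIn (ha : T.proj σ x = a.1) (hb : T.proj σ y = b.1) :
    ∃ L : Path a b, ∀ s, (L s).1 = T.proj σ (linePath x y s) := by
  refine ⟨⟨⟨fun s => ⟨T.proj σ (linePath x y s), ?_⟩, ?_⟩, ?_, ?_⟩, fun s => rfl⟩
  · rw [proj_mem_skeleton_iff, not_le]
    exact lt_suppCard_lineTo (lt_suppCard_of_proj_eq ha) (lt_suppCard_of_proj_eq hb) s
  · exact Continuous.subtype_mk ((T.continuous_proj σ).comp (linePath x y).continuous) _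
  · refine Subtype.ext ?_
    change T.proj σ (linePath x y 0) = _
    rw [(linePath x y).source, ha]
  · refine Subtype.ext ?_
    change T.proj σ (linePath x y 1) = _
    rw [(linePath x y).target, hb]

theorem exists_liesIn_facet {i : Fin (n + 1)} (hx : x i = 0) (hy : y i = 0)
    (ha : T.proj σ x = a.1) (hb : T.proj σ y = b.1) :
    ∃ L : Path a b, T.LiesIn L σ x y ∧ T.LiesIn L (T.pairing (σ, i)).1
      (permute (T.perspectivity (σ, i)) x) (permute (T.perspectivity (σ, i)) y) := by
  obtain ⟨L, hL⟩ := exists_liesIn ha hb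
  refine ⟨L, ⟨_, hL⟩, linePath _ _, fun s => ?_⟩
  rw [hL]
  exact T.proj_permute_perspectivity (x := lineTo x y s) (zeros_subset_lineTo s ⟨hx, hy⟩)

end LiesIn

/-! ### Facet paths -/

/-- The concatenation of facet paths. -/
def FacetPath.append {T : Triangulation n S} : {σ σ' σ'' : S} → T.FacetPath σ σ' →
    T.FacetPath σ' σ'' → T.FacetPath σ σ''
  | _, _, _, .nil _, γ' => γ'
  | _, _, _, .cons i γ, γ' => .cons i (γ.append γ')

theorem FacetPath.projectivity_append {T : Triangulation n S} {σ σ' σ'' : S}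
    (γ : T.FacetPath σ σ') (γ' : T.FacetPath σ' σ'') :
    (γ.append γ').projectivity = γ'.projectivity * γ.projectivity := by
  induction γ with
  | nil => exact (mul_one _).symm
  | cons i γ ih =>
    change (γ.append γ').projectivity * _ = _ * (_ * _)
    rw [ih, mul_assoc]

theorem FacetPath.mk_toPath_append {T : Triangulation n S} {j : ℕ} (hj : j + 3 ≤ n) {σ σ' σ'' : S}
    (γ : T.FacetPath σ σ') (γ' : T.FacetPath σ' σ'') :
    Path.Homotopic.Quotient.mk ((γ.append γ').toPath hj) =
      (Path.Homotopic.Quotient.mk (γ.toPath hj)).trans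
        (Path.Homotopic.Quotient.mk (γ'.toPath hj)) := by
  induction γ with
  | nil => exact (Path.Homotopic.Quotient.refl_trans _).symm
  | cons i γ ih =>
    change Path.Homotopic.Quotient.mk ((T.dualEdge hj _ i).trans ((γ.append γ').toPath hj)) =
      (Path.Homotopic.Quotient.mk ((T.dualEdge hj _ i).trans (γ.toPath hj))).trans _
    rw [Path.Homotopic.Quotient.mk_trans, ih, Path.Homotopic.Quotient.mk_trans,
      Path.Homotopic.Quotient.trans_assoc]

/-! ### Segments to barycentres and dual edges. -/

section HalfEdge

variable {T : Triangulation n S} {j : ℕ} {q : T.Complement j}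

theorem halfEdgePoint_zero (hn : 3 ≤ n) (i : Fin (n + 1)) :
    halfEdgePoint hn i 0 = halfEdgePoint hn 0 0 := by
  simp [halfEdgePoint]

theorem halfEdge_liesIn (hj : j + 3 ≤ n) (σ : S) (i : Fin (n + 1)) :
    T.LiesIn (T.halfEdge hj σ i) σ (halfEdgePoint (by omega) 0 0) (halfEdgePoint (by omega) i 1) :=
  ⟨⟨⟨halfEdgePoint (by omega) i, continuous_halfEdgePoint _ i⟩, halfEdgePoint_zero _ i, rfl⟩,
    fun _ => rfl⟩

theorem permute_halfEdgePoint (hn : 3 ≤ n) (σ : S) (i : Fin (n + 1)) :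
    permute (T.perspectivity (σ, i)) (halfEdgePoint hn i 1) =
      halfEdgePoint hn (T.pairing (σ, i)).2 1 := by
  refine (eq_permute_iff.2 fun v => ?_).symm
  change (1 - ((1 : unitInterval) : ℝ)) * _ + ((1 : unitInterval) : ℝ) *
        (if T.perspectivity (σ, i) v = (T.pairing (σ, i)).2 then 0 else (n : ℝ)⁻¹)
      = (1 - ((1 : unitInterval) : ℝ)) * _ + ((1 : unitInterval) : ℝ) *
        (if v = i then 0 else (n : ℝ)⁻¹)
  rw [← T.perspectivity_self (σ, i)]
  simp

theorem halfEdgePoint_one_self (hn : 3 ≤ n) (i : Fin (n + 1)) : halfEdgePoint hn i 1 i = 0 := by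
  change (1 - ((1 : unitInterval) : ℝ)) * _ + ((1 : unitInterval) : ℝ) * (if i = i then 0 else _)
      = (0 : ℝ)
  simp

/-- The straight paths from a point of a facet to the barycentres of the two adjacent simplices
differ by the dual edge across that facet. -/
theorem mk_eq_trans_dualEdge (hj : j + 3 ≤ n) {σ : S} {i : Fin (n + 1)}
    {x : stdSimplex ℝ (Fin (n + 1))} (hx : x i = 0)
    {κ : Path q (T.center hj σ)} {κ' : Path q (T.center hj (T.pairing (σ, i)).1)}
    (hκ : T.LiesIn κ σ x (halfEdgePoint (by omega) 0 0))
    (hκ' : T.LiesIn κ' (T.pairing (σ, i)).1 (permute (T.perspectivity (σ, i)) x)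
      (halfEdgePoint (by omega) 0 0)) :
    Path.Homotopic.Quotient.mk κ' = (Path.Homotopic.Quotient.mk κ).trans
      (Path.Homotopic.Quotient.mk (T.dualEdge hj σ i)) := by
  have h1 := T.halfEdge_liesIn hj σ i
  have h2 : T.LiesIn ((T.halfEdge hj (T.pairing (σ, i)).1 (T.pairing (σ, i)).2).symm.cast
      (T.halfEdgeMap_one hj σ i) rfl) (T.pairing (σ, i)).1
      (halfEdgePoint (by omega) (T.pairing (σ, i)).2 1) (halfEdgePoint (by omega) 0 0) :=
    (T.halfEdge_liesIn hj _ _).symm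
  -- The segment `m` from the point to the barycentre of the facet can be seen from both simplices,
  -- so each straight path can be replaced by `m` followed by half a dual edge.
  obtain ⟨m, hm, hm'⟩ := exists_liesIn_facet hx (halfEdgePoint_one_self (by omega) i)
    hκ.left h1.right
  rw [permute_halfEdgePoint] at hm'
  rw [hκ'.mk_eq_mk (hm'.trans h2), hκ.mk_eq_mk (hm.trans h1.symm), dualEdge]
  simp only [Path.Homotopic.Quotient.mk_trans, Path.Homotopic.Quotient.mk_symm,
    Path.Homotopic.Quotient.trans_assoc]
  rw [← Path.Homotopic.Quotient.trans_assoc (Path.Homotopic.Quotient.symm _),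
    Path.Homotopic.Quotient.symm_trans, Path.Homotopic.Quotient.refl_trans]

/-- Paths that go straight from a barycentre to a point and straight from this point to a
barycentre are homotopic to paths in the dual graph. -/
theorem exists_facetPath_of_liesIn (hj : j + 3 ≤ n) {σ σ' : S}
    {x x' : stdSimplex ℝ (Fin (n + 1))} {κ : Path (T.center hj σ) q} {κ' : Path q (T.center hj σ')}
    (hκ : T.LiesIn κ σ (halfEdgePoint (by omega) 0 0) x)
    (hκ' : T.LiesIn κ' σ' x' (halfEdgePoint (by omega) 0 0)) :
    ∃ γ : T.FacetPath σ σ', (Path.Homotopic.Quotient.mk κ).trans (Path.Homotopic.Quotient.mk κ') =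
      Path.Homotopic.Quotient.mk (γ.toPath hj) := by
  obtain ⟨π, hπ, rfl⟩ := T.proj_eq_proj_iff.1 (hκ.right.trans hκ'.left.symm)
  -- Induction on the word of reflections that carries the lift `x` to the other lift: each letter
  -- contributes one dual edge.
  suffices H : ∀ g : T.Frame, T.Reaches (zeros x) (σ, 1) g → ∀ κ' : Path q (T.center hj g.1),
      T.LiesIn κ' g.1 (permute g.2 x) (halfEdgePoint (by omega) 0 0) →
      ∃ γ : T.FacetPath σ g.1, (Path.Homotopic.Quotient.mk κ).trans
        (Path.Homotopic.Quotient.mk κ') = Path.Homotopic.Quotient.mk (γ.toPath hj) from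
    H _ hπ κ' hκ'
  intro g hg
  induction hg with
  | refl =>
    intro κ' hκ'
    refine ⟨.nil σ, ?_⟩
    have h : Path.Homotopic.Quotient.mk κ' = Path.Homotopic.Quotient.mk κ.symm :=
      hκ'.mk_eq_mk hκ.symm
    rw [h, Path.Homotopic.Quotient.mk_symm]
    exact Path.Homotopic.Quotient.trans_symm _
  | @tail g _ _ h ih =>
    obtain ⟨v, hv, rfl⟩ := h
    intro κ' hκ'
    have hq : T.proj g.1 (permute g.2 x) = q.1 := by
      rw [← hκ'.left]
      exact T.proj_permute_perspectivity ((permute_apply_apply _ x v).trans hv)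
    obtain ⟨κ₁, hκ₁⟩ := exists_liesIn (b := T.center hj g.1) hq rfl
    obtain ⟨γ, hγ⟩ := ih κ₁ ⟨_, hκ₁⟩
    refine ⟨γ.append (.cons (g.2 v) (.nil _)), ?_⟩
    rw [FacetPath.mk_toPath_append, ← hγ, Path.Homotopic.Quotient.trans_assoc]
    refine congrArg _ ((mk_eq_trans_dualEdge hj ((permute_apply_apply g.2 x v).trans hv)
      ⟨_, hκ₁⟩ hκ').trans (congrArg _ ?_))
    exact (Path.Homotopic.Quotient.trans_refl _).symm

end HalfEdge

/-! ### Paths between barycentres are homotopic to paths in the dual graph -/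

instance : ContractibleSpace unitInterval :=
  (convex_Icc (0 : ℝ) 1).contractibleSpace ⟨0, by simp⟩

instance : LocallyPathConnectedSpace unitInterval :=
  (isQuotientMap_projIcc (h := zero_le_one (α := ℝ))).locallyPathConnectedSpace

/-- This replaces all reparametrizations: it is applied to the interval and to the square as simply
connected domains. -/
theorem mk_eq_mk_of_comp {X Y : Type*} [TopologicalSpace X] [TopologicalSpace Y]
    [SimplyConnectedSpace Y] {f : Y → X} (hf : Continuous f) {a b : X} {y y' : Y} {δ δ' : Path y y'}
    {A A' : Path a b} (h : ∀ s, A s = f (δ s)) (h' : ∀ s, A' s = f (δ' s)) :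
    Path.Homotopic.Quotient.mk A = Path.Homotopic.Quotient.mk A' := by
  obtain rfl : a = f y := by simpa using h 0
  obtain rfl : b = f y' := by simpa using h 1
  obtain rfl : A = δ.map hf := Path.ext (funext h)
  obtain rfl : A' = δ'.map hf := Path.ext (funext h')
  rw [Path.Homotopic.Quotient.eq]
  exact (SimplyConnectedSpace.paths_homotopic δ δ').map ⟨f, hf⟩

theorem trans_apply_eq_of_comp {X Y : Type*} [TopologicalSpace X] [TopologicalSpace Y]
    {f : Y → X} {a b c : X} {y y' y'' : Y} {δ : Path y y'} {δ' : Path y' y''}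
    {A : Path a b} {A' : Path b c} (h : ∀ s, A s = f (δ s)) (h' : ∀ s, A' s = f (δ' s))
    (s : unitInterval) : A.trans A' s = f (δ.trans δ' s) := by
  rw [Path.trans_apply, Path.trans_apply]
  split_ifs
  · exact h _
  · exact h' _

/-- Every point of the complement of a skeleton has a neighbourhood in which each path is homotopic
to a path that consists of two segments. -/
theorem exists_nhds_mk_eq [Finite S] (T : Triangulation n S) {j : ℕ} (q : T.Complement j) :
    ∃ U : Set (T.Complement j), IsOpen U ∧ q ∈ U ∧
      ∀ (a b : T.Complement j) (α : Path a b), (∀ s, α s ∈ U) →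
      ∀ σ x σ' x', T.proj σ x = a.1 → T.proj σ' x' = b.1 →
      ∃ y y' : stdSimplex ℝ (Fin (n + 1)), ∃ (B : Path a q) (B' : Path b q),
        T.LiesIn B σ x y ∧ T.LiesIn B' σ' x' y' ∧
        Path.Homotopic.Quotient.mk α =
          (Path.Homotopic.Quotient.mk B).trans (Path.Homotopic.Quotient.mk B').symm := by
  obtain ⟨ε, hε, hr⟩ := T.exists_isRadius q.1
  obtain ⟨H, hHc, hH⟩ := hr.exists_contraction
  refine ⟨Subtype.val ⁻¹' T.star q.1 ε, hr.isOpen_star.preimage continuous_subtype_val,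
    T.mem_star_self _ hε, fun a b α hα σ x σ' x' hx hx' => ?_⟩
  have hmem : ∀ (u : T.star q.1 ε) t, u.1 ∉ T.skeleton j → H (u, t) ∉ T.skeleton j := by
    rintro ⟨u, hu⟩ t hus
    obtain ⟨⟨τ, y⟩, rfl⟩ := Quot.exists_rep u
    obtain ⟨z, hz, -, h⟩ := hH ⟨_, hu⟩ τ y rfl
    rw [h t, proj_mem_skeleton_iff, not_le]
    refine lt_suppCard_lineTo ?_ (lt_suppCard_of_proj_eq hz) t
    exact not_le.1 (mt T.proj_mem_skeleton_iff.2 hus)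
  -- The path `α` is contracted to `q` over a square: its bottom side is `α`, its top side is
  -- constant, and its vertical sides are the segments `B` and `B'`.
  let F : unitInterval × unitInterval → T.Complement j := fun p =>
    ⟨H (⟨(α p.1).1, hα p.1⟩, p.2), hmem _ _ (α p.1).2⟩
  have hF : Continuous F := by
    refine Continuous.subtype_mk (hHc.comp (Continuous.prodMk (Continuous.subtype_mk ?_ _)
      continuous_snd)) _
    exact continuous_subtype_val.comp (α.continuous.comp continuous_fst)
  have hF0 : ∀ s, F (s, 0) = α s := by
    intro s
    obtain ⟨⟨τ, y⟩, hy⟩ := Quot.exists_rep (α s).1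
    obtain ⟨z, -, -, h⟩ := hH ⟨_, hα s⟩ τ y hy
    refine Subtype.ext ((h 0).trans ?_)
    rw [lineTo_zero]
    exact hy
  have hF1 : ∀ s, F (s, 1) = q := by
    intro s
    obtain ⟨⟨τ, y⟩, hy⟩ := Quot.exists_rep (α s).1
    obtain ⟨z, hz, -, h⟩ := hH ⟨_, hα s⟩ τ y hy
    refine Subtype.ext ((h 1).trans ?_)
    rw [lineTo_one]
    exact hz
  obtain ⟨y, -, -, hy⟩ := hH ⟨_, hα 0⟩ σ x (hx.trans (congrArg Subtype.val α.source.symm))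
  obtain ⟨y', -, -, hy'⟩ := hH ⟨_, hα 1⟩ σ' x' (hx'.trans (congrArg Subtype.val α.target.symm))
  let δ₀ : Path ((0 : unitInterval), (0 : unitInterval)) (0, 1) :=
    ⟨⟨fun t => (0, t), by fun_prop⟩, rfl, rfl⟩
  let δ₁ : Path ((1 : unitInterval), (0 : unitInterval)) (1, 1) :=
    ⟨⟨fun t => (1, t), by fun_prop⟩, rfl, rfl⟩
  let ε₀ : Path ((0 : unitInterval), (0 : unitInterval)) (1, 0) :=
    ⟨⟨fun t => (t, 0), by fun_prop⟩, rfl, rfl⟩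
  let ε₁ : Path ((0 : unitInterval), (1 : unitInterval)) (1, 1) :=
    ⟨⟨fun t => (t, 1), by fun_prop⟩, rfl, rfl⟩
  let B : Path a q := ⟨⟨fun t => F (0, t), by fun_prop⟩, by simp [hF0], hF1 0⟩
  let B' : Path b q := ⟨⟨fun t => F (1, t), by fun_prop⟩, by simp [hF0], hF1 1⟩
  refine ⟨y, y', B, B', ⟨linePath x y, hy⟩, ⟨linePath x' y', hy'⟩, ?_⟩
  rw [← Path.Homotopic.Quotient.mk_symm, ← Path.Homotopic.Quotient.mk_trans]
  -- The constant path is inserted so that the composition is the image of the other three sides of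
  -- the square.
  have h1 : Path.Homotopic.Quotient.mk (B.trans B'.symm) =
      Path.Homotopic.Quotient.mk (B.trans ((Path.refl q).trans B'.symm)) := by
    simp only [Path.Homotopic.Quotient.mk_trans, Path.Homotopic.Quotient.mk_refl,
      Path.Homotopic.Quotient.refl_trans]
  rw [h1]
  refine mk_eq_mk_of_comp hF (δ := ε₀) (δ' := δ₀.trans (ε₁.trans δ₁.symm))
    (fun s => (hF0 s).symm) ?_
  exact trans_apply_eq_of_comp (fun s => rfl)
    (trans_apply_eq_of_comp (fun s => (hF1 s).symm) fun s => rfl)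

/-- Every path between barycentres is homotopic to a path in the dual graph. -/
theorem exists_facetPath_mk_eq [Finite S] (T : Triangulation n S) {j : ℕ} (hj : j + 3 ≤ n)
    {σ₀ σ₁ : S} (p : Path (T.center hj σ₀) (T.center hj σ₁)) :
    ∃ γ : T.FacetPath σ₀ σ₁,
      Path.Homotopic.Quotient.mk p = Path.Homotopic.Quotient.mk (γ.toPath hj) := by
  -- The property quantifies over all representatives `A` of the initial part of `p` and all final
  -- segments `L`. It is therefore locally constant, and connectedness of the interval replaces a
  -- subdivision of `p`.
  let P : unitInterval → Prop := fun t =>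
    ∀ (A : Path (T.center hj σ₀) (p t)) (δ : Path 0 t), (∀ s, A s = p (δ s)) →
    ∀ (σ : S) (x : stdSimplex ℝ (Fin (n + 1))) (L : Path (p t) (T.center hj σ)),
      T.LiesIn L σ x (halfEdgePoint (by omega) 0 0) →
    ∃ γ : T.FacetPath σ₀ σ, (Path.Homotopic.Quotient.mk A).trans (Path.Homotopic.Quotient.mk L) =
      Path.Homotopic.Quotient.mk (γ.toPath hj)
  have hstep : ∀ t, ∃ N ∈ nhds t, ∀ s ∈ N, ∀ s' ∈ N, P s → P s' := by
    intro t
    obtain ⟨U, hU, htU, h⟩ := T.exists_nhds_mk_eq (p t)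
    obtain ⟨N, ⟨hN, hNc⟩, hNU⟩ := (path_connected_basis t).mem_iff.1
      ((hU.preimage p.continuous).mem_nhds htU)
    refine ⟨N, hN, fun s hs s' hs' hP A' δ' hA' σ' x' L' hL' => ?_⟩
    obtain ⟨β, hβ⟩ := hNc.joinedIn s hs s' hs'
    obtain ⟨⟨σ, x⟩, hx⟩ := Quot.exists_rep (p s).1
    obtain ⟨L, hL⟩ := exists_liesIn (b := T.center hj σ) hx rfl
    have hL : T.LiesIn L σ x _ := ⟨_, hL⟩
    let δ : Path 0 s := PathConnectedSpace.somePath 0 s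
    let A : Path (T.center hj σ₀) (p s) := (δ.map p.continuous).cast p.source.symm rfl
    obtain ⟨γ, hγ⟩ := hP A δ (fun _ => rfl) σ x L hL
    obtain ⟨y, y', B, B', hB, hB', hα⟩ := h _ _ (β.map p.continuous) (fun τ => hNU (hβ τ))
      σ x σ' x' hx hL'.left
    obtain ⟨γ', hγ'⟩ := exists_facetPath_of_liesIn hj (hL.symm.trans hB) (hB'.symm.trans hL')
    refine ⟨γ.append γ', ?_⟩
    have hA : Path.Homotopic.Quotient.mk A' =
        Path.Homotopic.Quotient.mk (A.trans (β.map p.continuous)) :=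
      mk_eq_mk_of_comp p.continuous (δ := δ') (δ' := δ.trans β) hA'
        (trans_apply_eq_of_comp (fun _ => rfl) fun _ => rfl)
    rw [FacetPath.mk_toPath_append, ← hγ, ← hγ', hA]
    simp only [Path.Homotopic.Quotient.mk_trans, Path.Homotopic.Quotient.mk_symm, hα,
      Path.Homotopic.Quotient.trans_assoc]
    rw [← Path.Homotopic.Quotient.trans_assoc (Path.Homotopic.Quotient.mk L),
      Path.Homotopic.Quotient.trans_symm, Path.Homotopic.Quotient.refl_trans]
  have hconst : IsLocallyConstant P := by
    rw [IsLocallyConstant.iff_eventually_eq]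
    intro t
    obtain ⟨N, hN, h⟩ := hstep t
    filter_upwards [hN] with s hs
    exact propext ⟨h s hs t (mem_of_mem_nhds hN), h t (mem_of_mem_nhds hN) s hs⟩
  have h0 : P 0 := by
    intro A δ hA σ x L hL
    let K : Path (T.center hj σ₀) (p 0) := (Path.refl (T.center hj σ₀)).cast rfl p.source
    have hK : T.LiesIn K σ₀ (halfEdgePoint (by omega) 0 0) (halfEdgePoint (by omega) 0 0) :=
      ⟨Path.refl _, fun _ => rfl⟩
    have : Path.Homotopic.Quotient.mk A = Path.Homotopic.Quotient.mk K :=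
      mk_eq_mk_of_comp p.continuous (δ := δ) (δ' := Path.refl 0) hA fun _ => p.source.symm
    rw [this]
    exact exists_facetPath_of_liesIn hj hK hL
  have h1 : P 1 := by
    rw [← hconst.apply_eq_of_preconnectedSpace 0 1]
    exact h0
  -- The points `p 1` and `T.center hj σ₁` are equal only propositionally, so the last segment is a
  -- constant path with a cast endpoint.
  have hend : ∀ (b : T.Complement j) (hb : b = T.center hj σ₁),
      (Path.Homotopic.Quotient.mk (p.cast rfl hb)).trans
        (Path.Homotopic.Quotient.mk ((Path.refl (T.center hj σ₁)).cast hb rfl)) =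
      Path.Homotopic.Quotient.mk p := by
    rintro _ rfl
    exact Path.Homotopic.Quotient.trans_refl _
  rw [← hend (p 1) p.target]
  exact h1 _ ⟨⟨id, continuous_id⟩, rfl, rfl⟩ (fun _ => rfl) σ₁ (halfEdgePoint (by omega) 0 0) _
    ⟨Path.refl _, fun _ => rfl⟩

end Triangulation
namespace Triangulation

variable {n : ℕ} {S : Type*}

/-! ### The covering of the corners -/

/-- Points with a chosen corner, up to the identification by the perspectivities. -/
def cornerSetoid (T : Triangulation n S) : Setoid (T.Points × Fin (n + 1)) where
  r p q := ∃ π : Equiv.Perm (Fin (n + 1)), T.Reaches (zeros p.1.2) (p.1.1, 1) (q.1.1, π) ∧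
    q.1.2 = permute π p.1.2 ∧ q.2 = π p.2
  iseqv := by
    refine ⟨fun p => ⟨1, Reaches.refl _, rfl, rfl⟩, ?_, ?_⟩
    · rintro p q ⟨π, h1, h2, h3⟩
      refine ⟨π⁻¹, ?_, by rw [h2, permute_permute, inv_mul_cancel, permute_one], ?_⟩
      · have := h1.symm.relabel (Z' := zeros q.1.2) π⁻¹ fun v hv => by
          rw [h2, mem_zeros, permute_apply]; exact hv
        simpa [Triangulation.relabel] using this
      · rw [h3]
        exact (π.symm_apply_apply _).symm
    · rintro p q r ⟨π, h1, h2, h3⟩ ⟨π', h1', h2', h3'⟩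
      refine ⟨π' * π, h1.trans ?_, by rw [h2', h2, permute_permute], by rw [h3', h3]; rfl⟩
      have := h1'.relabel (Z' := zeros p.1.2) π fun v hv => by
        rw [h2, mem_zeros, permute_apply_apply] at hv; exact hv
      simpa [Triangulation.relabel] using this

/-- The space of points with a chosen corner. -/
abbrev CornerSpace (T : Triangulation n S) : Type _ := Quotient T.cornerSetoid

/-- The class of the point `x` of `σ` with the chosen corner `v`. -/
abbrev corner (T : Triangulation n S) (σ : S) (x : stdSimplex ℝ (Fin (n + 1)))
    (v : Fin (n + 1)) : T.CornerSpace :=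
  Quotient.mk T.cornerSetoid (⟨σ, x⟩, v)

/-- Forgetting the corner. -/
def forget (T : Triangulation n S) : T.CornerSpace → T.Space :=
  Quotient.lift (fun p => T.proj p.1.1 p.1.2) fun _ _ ⟨π, h1, h2, _⟩ =>
    T.proj_eq_proj_iff.2 ⟨π, h1, h2⟩

theorem continuous_forget (T : Triangulation n S) : Continuous T.forget :=
  Continuous.quotient_lift (continuous_quot_mk.comp continuous_fst) _

theorem corner_eq_corner_iff (T : Triangulation n S) {σ σ' : S}
    {x x' : stdSimplex ℝ (Fin (n + 1))} {v v' : Fin (n + 1)} :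
    T.corner σ x v = T.corner σ' x' v' ↔
      ∃ π, T.Reaches (zeros x) (σ, 1) (σ', π) ∧ x' = permute π x ∧ v' = π v :=
  Quotient.eq

theorem exists_corner_eq (T : Triangulation n S) (e : T.CornerSpace) {σ : S}
    {x : stdSimplex ℝ (Fin (n + 1))} (h : T.proj σ x = T.forget e) : ∃ v, T.corner σ x v = e := by
  obtain ⟨⟨⟨σ', x'⟩, v'⟩, rfl⟩ := Quotient.exists_rep e
  obtain ⟨π, h1, h2⟩ := T.proj_eq_proj_iff.1 h
  refine ⟨π⁻¹ v', T.corner_eq_corner_iff.2 ⟨π, h1, h2, ?_⟩⟩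
  exact (π.apply_symm_apply _).symm

/-- The monodromy of the corners around the points outside the `j`-skeleton is trivial. -/
def TrivialMonodromy (T : Triangulation n S) (j : ℕ) : Prop :=
  ∀ (σ : S) (x : stdSimplex ℝ (Fin (n + 1))) (π : Equiv.Perm (Fin (n + 1))),
    j + 1 < suppCard x → T.Reaches (zeros x) (σ, 1) (σ, π) → permute π x = x → π = 1

/-- The bound on `j` leaves at most two vanishing coordinates outside the skeleton, and a
permutation that fixes the point preserves their labels. -/
theorem trivialMonodromy [Finite S] (T : Triangulation n S) (hT : T.IsEven) (hR : T.RigidFaces)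
    {j : ℕ} (hj : n ≤ j + 3) : T.TrivialMonodromy j := by
  intro σ x π hx h hπ
  refine T.eq_one_of_reaches_relabel (f := (σ, 1)) (Z := zeros x) hT hR ?_ (fun v => ?_)
    (by simpa [relabel] using h)
  · have := suppCard_add_ncard_zeros x
    omega
  · rw [mem_zeros, mem_zeros]
    have := permute_apply_apply π x v
    rw [hπ] at this
    rw [this]

section Frames

variable {T : Triangulation n S} {j : ℕ} {σ₁ : S} {x₁ : stdSimplex ℝ (Fin (n + 1))} {ε : ℝ}

/-- The point `y` of `σ` is close to the preimage of a given point that is reached from a reference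
frame by reflections with result `π`. -/
def IsNearFrame (T : Triangulation n S) (σ₁ : S) (x₁ : stdSimplex ℝ (Fin (n + 1))) (ε : ℝ) (σ : S)
    (y : stdSimplex ℝ (Fin (n + 1))) (π : Equiv.Perm (Fin (n + 1))) : Prop :=
  T.Reaches (zeros x₁) (σ₁, 1) (σ, π) ∧ dist y (permute π x₁) < ε

/-- The two centres are less than `2 * ε` apart and hence agree, so the frames differ by a monodromy
around the centre. Uniqueness is what labels the corners over a star consistently. -/
theorem IsNearFrame.eq (hm : T.TrivialMonodromy j) (hr : T.IsRadius (T.proj σ₁ x₁) ε)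
    (hx₁ : j + 1 < suppCard x₁) {σ : S} {y : stdSimplex ℝ (Fin (n + 1))}
    {π π' : Equiv.Perm (Fin (n + 1))} (h : T.IsNearFrame σ₁ x₁ ε σ y π)
    (h' : T.IsNearFrame σ₁ x₁ ε σ y π') : π = π' := by
  have hd := dist_triangle_left (permute π x₁) (permute π' x₁) y
  have hp : permute π x₁ = permute π' x₁ := by
    refine hr.eq_of_dist_lt (σ := σ) ?_ ?_ (by linarith [h.2, h'.2])
    · exact (T.proj_eq_proj_iff.2 ⟨π, h.1, rfl⟩).symm
    · exact (T.proj_eq_proj_iff.2 ⟨π', h'.1, rfl⟩).symm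
  have h1 := (h.1.symm.trans h'.1).relabel (Z' := zeros (permute π x₁)) π⁻¹ fun v hv => by
    rw [mem_zeros, permute_apply]; exact hv
  have h2 := hm σ (permute π x₁) (π' * π⁻¹) (by rwa [suppCard_permute])
    (by simpa [Triangulation.relabel] using h1)
    (by rw [permute_permute, mul_assoc, inv_mul_cancel, mul_one, hp])
  exact (mul_inv_eq_one.1 h2).symm

theorem IsNearFrame.reaches (hr : T.IsRadius (T.proj σ₁ x₁) ε) {σ σ' : S}
    {y : stdSimplex ℝ (Fin (n + 1))} {π π' : Equiv.Perm (Fin (n + 1))}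
    (h : T.IsNearFrame σ₁ x₁ ε σ y π) (h' : T.Reaches (zeros y) (σ, 1) (σ', π')) :
    T.IsNearFrame σ₁ x₁ ε σ' (permute π' y) (π' * π) := by
  refine ⟨h.1.trans ?_, by rw [← permute_permute, dist_permute]; exact h.2⟩
  have hz := hr.zeros_subset (T.proj_eq_proj_iff.2 ⟨π, h.1, rfl⟩).symm h.2
  have := h'.relabel (Z' := zeros x₁) π fun v hv => by
    have := hz hv
    rwa [mem_zeros, permute_apply_apply] at this
  simpa [Triangulation.relabel] using this

theorem exists_isNearFrame_iff (hr : T.IsRadius (T.proj σ₁ x₁) ε) {σ : S}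
    {y : stdSimplex ℝ (Fin (n + 1))} :
    (∃ π, T.IsNearFrame σ₁ x₁ ε σ y π) ↔ T.proj σ y ∈ T.star (T.proj σ₁ x₁) ε := by
  rw [hr.proj_mem_star_iff]
  constructor
  · rintro ⟨π, h1, h2⟩
    exact ⟨_, (T.proj_eq_proj_iff.2 ⟨π, h1, rfl⟩).symm, h2⟩
  · rintro ⟨x, h1, h2⟩
    obtain ⟨π, h3, rfl⟩ := T.proj_eq_proj_iff.1 h1.symm
    exact ⟨π, h3, h2⟩

end Frames

/-- Forgetting the corner is a covering map outside the skeleton around which the monodromy is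
trivial. -/
theorem isCoveringMapOn_forget [Finite S] (T : Triangulation n S) {j : ℕ}
    (hm : T.TrivialMonodromy j) : IsCoveringMapOn T.forget (T.skeleton j)ᶜ := by
  intro q hq
  obtain ⟨⟨σ₁, x₁⟩, rfl⟩ := Quot.exists_rep q
  change T.proj σ₁ x₁ ∉ _ at hq
  rw [proj_mem_skeleton_iff, not_le] at hq
  obtain ⟨ε, hε, hr⟩ := T.exists_isRadius (T.proj σ₁ x₁)
  have hopen := hr.isOpen_star
  have hself := T.mem_star_self (T.proj σ₁ x₁) hε
  have hex : ∀ {σ y}, T.proj σ y ∈ T.star (T.proj σ₁ x₁) ε →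
      ∃ π, T.IsNearFrame σ₁ x₁ ε σ y π := fun h => (exists_isNearFrame_iff hr).2 h
  have heq : ∀ {σ y π π'}, T.IsNearFrame σ₁ x₁ ε σ y π → T.IsNearFrame σ₁ x₁ ε σ y π' → π = π' :=
    fun h h' => h.eq hm hr hq h'
  have hreach : ∀ {σ σ' y π π'}, T.IsNearFrame σ₁ x₁ ε σ y π →
      T.Reaches (zeros y) (σ, 1) (σ', π') →
      T.IsNearFrame σ₁ x₁ ε σ' (permute π' y) (π' * π) := fun h h' => h.reaches hr h'
  have hball : ∀ {σ y π}, T.IsNearFrame σ₁ x₁ ε σ y π → ∀ {z}, z ∈ Metric.ball (permute π x₁) ε →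
      T.IsNearFrame σ₁ x₁ ε σ z π := fun h _ hz => ⟨h.1, hz⟩
  -- From here on the star is an open set known only through the facts about near frames just
  -- collected.
  generalize T.star (T.proj σ₁ x₁) ε = U at *
  -- the label of a corner and the corner with a given label
  have hlabel : ∀ e : T.forget ⁻¹' U, ∃ w, ∀ σ y v π, T.corner σ y v = e →
      T.IsNearFrame σ₁ x₁ ε σ y π → π⁻¹ v = w := by
    rintro ⟨e, he⟩
    obtain ⟨⟨⟨σ, y⟩, v⟩, rfl⟩ := Quotient.exists_rep e
    obtain ⟨π, hπ⟩ := hex he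
    refine ⟨π⁻¹ v, fun σ' y' v' π' h' hπ' => ?_⟩
    obtain ⟨θ, h1, h2, h3⟩ := T.corner_eq_corner_iff.1 h'
    have := heq (h2 ▸ hreach hπ' h1) hπ
    rw [h3, ← this, mul_inv_rev]
    exact congrArg _ (θ.symm_apply_apply _).symm
  have hcorner : ∀ p : U × Fin (n + 1), ∃ e : T.forget ⁻¹' U, ∀ σ y π, T.proj σ y = p.1 →
      T.IsNearFrame σ₁ x₁ ε σ y π → T.corner σ y (π p.2) = e := by
    rintro ⟨⟨u, hu⟩, w⟩
    obtain ⟨⟨σ, y⟩, rfl⟩ := Quot.exists_rep u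
    obtain ⟨π, hπ⟩ := hex hu
    refine ⟨⟨T.corner σ y (π w), hu⟩, fun σ' y' π' h' hπ' => ?_⟩
    obtain ⟨θ, h1, h2⟩ := T.proj_eq_proj_iff.1 h'
    refine T.corner_eq_corner_iff.2 ⟨θ, h1, h2, ?_⟩
    rw [← heq (h2 ▸ hreach hπ' h1) hπ]
    rfl
  choose label hlabel using hlabel
  choose corn hcorn using hcorner
  have hforget : ∀ p, T.forget (corn p).1 = p.1 := by
    rintro ⟨⟨u, hu⟩, w⟩
    obtain ⟨⟨σ, y⟩, rfl⟩ := Quot.exists_rep u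
    obtain ⟨π, hπ⟩ := hex hu
    rw [← hcorn _ σ y π rfl hπ]
    rfl
  have hcont_label : Continuous label := by
    have hquot : Topology.IsQuotientMap ((T.forget ⁻¹' U).restrictPreimage
        (Quotient.mk T.cornerSetoid)) :=
      Topology.IsQuotientMap.restrictPreimage_isOpen isQuotientMap_quot_mk
        (hopen.preimage T.continuous_forget)
    rw [hquot.continuous_iff, continuous_iff_continuousAt]
    rintro ⟨⟨⟨σ, y⟩, v⟩, hy⟩
    obtain ⟨π, hπ⟩ := hex hy
    have ho : IsOpen {p : (Quotient.mk T.cornerSetoid ⁻¹' (T.forget ⁻¹' U) : Set (T.Points × Fin (n + 1))) |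
        p.1 ∈ (Sigma.mk σ '' Metric.ball (permute π x₁) ε) ×ˢ {v}} :=
      ((isOpenMap_sigmaMk (σ := fun _ : S => stdSimplex ℝ (Fin (n + 1))) (i := σ) _
        Metric.isOpen_ball).prod (isOpen_discrete {v})).preimage continuous_subtype_val
    -- The label of a fixed corner is constant on the ball of one near frame.
    refine (continuousAt_const (y := π⁻¹ v)).congr ?_
    filter_upwards [ho.mem_nhds ⟨⟨y, hπ.2, rfl⟩, rfl⟩]
    rintro ⟨⟨_, _⟩, hz⟩ ⟨⟨z, hz', rfl⟩, rfl⟩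
    exact hlabel ⟨_, hz⟩ σ z _ π rfl (hball hπ hz')
  have hcont_corn : Continuous corn := by
    have hquot := (isQuotientMap_quot_mk (r := T.Identifies)).restrictPreimage_isOpen hopen
    refine hquot.continuous_lift_prod_left ?_
    refine continuous_induced_rng.2 ?_
    rw [continuous_iff_continuousAt]
    rintro ⟨⟨⟨σ, y⟩, hy⟩, w⟩
    obtain ⟨π, hπ⟩ := hex hy
    have ho : IsOpen {p : (Quot.mk T.Identifies ⁻¹' U) × Fin (n + 1) |
        p.1.1 ∈ Sigma.mk σ '' Metric.ball (permute π x₁) ε} :=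
      (isOpenMap_sigmaMk (σ := fun _ : S => stdSimplex ℝ (Fin (n + 1))) (i := σ) _
        Metric.isOpen_ball).preimage (continuous_subtype_val.comp continuous_fst)
    have hc : Continuous fun p : (Quot.mk T.Identifies ⁻¹' U) × Fin (n + 1) =>
        (Quotient.mk T.cornerSetoid (p.1.1, π p.2) : T.CornerSpace) :=
      continuous_quotient_mk'.comp ((continuous_subtype_val.comp continuous_fst).prodMk
        (continuous_of_discreteTopology.comp continuous_snd))
    refine hc.continuousAt.congr ?_
    filter_upwards [ho.mem_nhds ⟨y, hπ.2, rfl⟩]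
    rintro ⟨⟨_, hz⟩, w'⟩ ⟨z, hz', rfl⟩
    exact hcorn (⟨_, hz⟩, w') σ z π rfl (hball hπ hz')
  have hlc : ∀ p, label (corn p) = p.2 := by
    rintro ⟨⟨u, hu⟩, w⟩
    obtain ⟨⟨σ, y⟩, rfl⟩ := Quot.exists_rep u
    obtain ⟨π, hπ⟩ := hex hu
    rw [← hlabel _ σ y _ π (hcorn _ σ y π rfl hπ) hπ]
    exact π.symm_apply_apply w
  have hcl : ∀ e : T.forget ⁻¹' U, corn (⟨T.forget e, e.2⟩, label e) = e := by
    rintro ⟨e, he⟩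
    obtain ⟨⟨⟨σ, y⟩, v⟩, rfl⟩ := Quotient.exists_rep e
    obtain ⟨π, hπ⟩ := hex he
    refine Subtype.ext ?_
    rw [← hcorn _ σ y π rfl hπ, ← hlabel _ σ y v π rfl hπ]
    exact congrArg _ (π.apply_symm_apply v)
  have hcov : IsEvenlyCovered T.forget (T.proj σ₁ x₁) (Fin (n + 1)) :=
    ⟨inferInstance, U, hself, hopen, hopen.preimage T.continuous_forget,
      { toFun := fun e => (⟨T.forget e, e.2⟩, label e)
        invFun := corn
        left_inv := hcl
        right_inv := fun p => Prod.ext (Subtype.ext (hforget p)) (hlc p)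
        continuous_toFun := by
          refine Continuous.prodMk (Continuous.subtype_mk ?_ _) hcont_label
          exact T.continuous_forget.comp continuous_subtype_val
        continuous_invFun := hcont_corn }, fun _ => rfl⟩
  exact hcov.to_isEvenlyCovered_preimage

/-! ### Existence and uniqueness of canonical symmetric representations -/

/-- The corner covering of the complement of the `j`-skeleton. -/
def forgetComplement (T : Triangulation n S) (j : ℕ) :
    {e : T.CornerSpace // T.forget e ∉ T.skeleton j} → T.Complement j :=
  fun e => ⟨T.forget e.1, e.2⟩

theorem isCoveringMap_forgetComplement [Finite S] (T : Triangulation n S) {j : ℕ}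
    (hm : T.TrivialMonodromy j) : IsCoveringMap (T.forgetComplement j) :=
  (T.isCoveringMapOn_forget hm).isCoveringMap_restrictPreimage

/-- A path inside one simplex lifts by keeping the chosen corner. -/
theorem monodromy_of_liesIn {T : Triangulation n S} {j : ℕ}
    (cov : IsCoveringMap (T.forgetComplement j)) {a b : T.Complement j} {L : Path a b} {σ : S}
    {x y : stdSimplex ℝ (Fin (n + 1))} (hL : T.LiesIn L σ x y) (v : Fin (n + 1))
    (ex : T.forgetComplement j ⁻¹' {a}) (ey : T.forgetComplement j ⁻¹' {b})
    (hx : ex.1.1 = T.corner σ x v) (hy : ey.1.1 = T.corner σ y v) :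
    cov.monodromy (Path.Homotopic.Quotient.mk L) ex = ey := by
  obtain ⟨ℓ, hℓ⟩ := hL
  have hmem : ∀ s, T.forget (T.corner σ (ℓ s) v) ∉ T.skeleton j := fun s => by
    change T.proj σ (ℓ s) ∉ _
    rw [← hℓ s]
    exact (L s).2
  let Γ : Path ex.1 ey.1 :=
    ⟨⟨fun s => ⟨T.corner σ (ℓ s) v, hmem s⟩, Continuous.subtype_mk
      (continuous_quotient_mk'.comp ((((continuous_sigmaMk
        (σ := fun _ : S => stdSimplex ℝ (Fin (n + 1)))).comp ℓ.continuous)).prodMk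
          continuous_const)) _⟩,
      Subtype.ext (by simp [hx]), Subtype.ext (by simp [hy])⟩
  refine cov.monodromy_eq_of_map_eq (Path.Homotopic.Quotient.mk Γ) ?_
  refine congrArg Path.Homotopic.Quotient.mk (Path.ext (funext fun s => ?_))
  exact Subtype.ext (hℓ s).symm

/-- The corners of the simplex `σ` as points over its barycentre. -/
noncomputable def cornerFiber (T : Triangulation n S) {j : ℕ} (hj : j + 3 ≤ n) (σ : S) (v : Fin (n + 1)) :
    T.forgetComplement j ⁻¹' {T.center hj σ} :=
  ⟨⟨T.corner σ (halfEdgePoint (by omega) 0 0) v, (T.center hj σ).2⟩, rfl⟩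

/-- At the barycentre of the facet, the corner `v` of one simplex is the same point of the covering
as its image under the perspectivity in the other (`hmid`). -/
theorem monodromy_dualEdge {T : Triangulation n S} {j : ℕ}
    (cov : IsCoveringMap (T.forgetComplement j)) (hj : j + 3 ≤ n) (σ : S) (i v : Fin (n + 1)) :
    cov.monodromy (Path.Homotopic.Quotient.mk (T.dualEdge hj σ i)) (T.cornerFiber hj σ v) =
      T.cornerFiber hj (T.pairing (σ, i)).1 (T.perspectivity (σ, i) v) := by
  have h2 : T.LiesIn ((T.halfEdge hj (T.pairing (σ, i)).1 (T.pairing (σ, i)).2).symm.cast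
      (T.halfEdgeMap_one hj σ i) rfl) (T.pairing (σ, i)).1
      (halfEdgePoint (by omega) (T.pairing (σ, i)).2 1) (halfEdgePoint (by omega) 0 0) :=
    (T.halfEdge_liesIn hj _ _).symm
  have hmid : T.corner σ (halfEdgePoint (by omega) i 1) v = T.corner (T.pairing (σ, i)).1
      (halfEdgePoint (by omega) (T.pairing (σ, i)).2 1) (T.perspectivity (σ, i) v) := by
    refine T.corner_eq_corner_iff.2 ⟨T.perspectivity (σ, i), ?_,
      (permute_halfEdgePoint (by omega) σ i).symm, rfl⟩
    have := Reaches.cross (T := T) (Z := zeros (halfEdgePoint (by omega) i 1))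
      (halfEdgePoint_one_self (by omega) i) (σ, 1)
    simpa [cross] using this
  rw [dualEdge, Path.Homotopic.Quotient.mk_trans, cov.monodromy_trans_apply,
    monodromy_of_liesIn cov (T.halfEdge_liesIn hj σ i) v _
      ⟨⟨T.corner σ (halfEdgePoint (by omega) i 1) v, (T.halfEdgeMap hj σ i 1).2⟩, rfl⟩ rfl rfl]
  exact monodromy_of_liesIn cov h2 (T.perspectivity (σ, i) v) _ _ hmid rfl

theorem monodromy_toPath {T : Triangulation n S} {j : ℕ}
    (cov : IsCoveringMap (T.forgetComplement j)) (hj : j + 3 ≤ n) {σ σ' : S}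
    (γ : T.FacetPath σ σ') (v : Fin (n + 1)) :
    cov.monodromy (Path.Homotopic.Quotient.mk (γ.toPath hj)) (T.cornerFiber hj σ v) =
      T.cornerFiber hj σ' (γ.projectivity v) := by
  induction γ generalizing v with
  | nil σ => exact congrFun cov.monodromy_refl _
  | @cons σ σ' i γ ih =>
    have h : Path.Homotopic.Quotient.mk (FacetPath.toPath hj (.cons i γ)) =
        (Path.Homotopic.Quotient.mk (T.dualEdge hj σ i)).trans
          (Path.Homotopic.Quotient.mk (γ.toPath hj)) := rfl
    rw [h, cov.monodromy_trans_apply, monodromy_dualEdge, ih]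
    rfl

theorem cornerFiber_bijective (T : Triangulation n S) {j : ℕ} (hm : T.TrivialMonodromy j)
    (hj : j + 3 ≤ n) (σ : S) : Function.Bijective (T.cornerFiber hj σ) := by
  constructor
  · intro v w h
    have h1 : T.corner σ (halfEdgePoint (by omega) 0 0) v =
        T.corner σ (halfEdgePoint (by omega) 0 0) w := congrArg (fun e => e.1.1) h
    obtain ⟨π, h2, h3, h4⟩ := T.corner_eq_corner_iff.1 h1
    rw [h4, hm σ _ π (lt_suppCard_halfEdgePoint _ hj 0 0) h2 h3.symm]
    rfl
  · rintro ⟨⟨e, he⟩, he'⟩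
    have he'' : T.forgetComplement j ⟨e, he⟩ = T.center hj σ := he'
    obtain ⟨v, hv⟩ := T.exists_corner_eq e (congrArg Subtype.val he'').symm
    exact ⟨v, Subtype.ext (Subtype.ext hv)⟩

theorem exists_isCanonicalRep [Finite S] (T : Triangulation n S) {j : ℕ}
    (hm : T.TrivialMonodromy j) (hj : j + 3 ≤ n) (σ₀ : S) :
    ∃ ρ : FundamentalGroup (T.Complement j) (T.center hj σ₀) →* Equiv.Perm (Fin (n + 1)),
      T.IsCanonicalRep hj σ₀ ρ := by
  have cov := T.isCoveringMap_forgetComplement hm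
  let e := Equiv.ofBijective _ (T.cornerFiber_bijective hm hj σ₀)
  refine ⟨e.symm.permCongrHom.toMonoidHom.comp (cov.monodromyPerm _), fun γ => ?_⟩
  refine Equiv.ext fun v => ?_
  change e.symm (cov.monodromy (Path.Homotopic.Quotient.mk (γ.toPath hj)) (e v)) = _
  rw [Equiv.symm_apply_eq]
  exact monodromy_toPath cov hj γ v

/-- This reduces every statement about the fundamental group to facet loops, on which canonical
representations are prescribed. -/
theorem exists_facetPath_eq [Finite S] (T : Triangulation n S) {j : ℕ} (hj : j + 3 ≤ n) (σ₀ : S)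
    (g : FundamentalGroup (T.Complement j) (T.center hj σ₀)) : ∃ γ : T.FacetPath σ₀ σ₀,
      g = FundamentalGroup.fromPath (Path.Homotopic.Quotient.mk (γ.toPath hj)) := by
  obtain ⟨p, rfl⟩ := Path.Homotopic.Quotient.mk_surjective g
  exact T.exists_facetPath_mk_eq hj p

theorem IsCanonicalRep.unique [Finite S] {T : Triangulation n S} {j : ℕ} {hj : j + 3 ≤ n} {σ₀ : S}
    {ρ ρ' : FundamentalGroup (T.Complement j) (T.center hj σ₀) →* Equiv.Perm (Fin (n + 1))}
    (h : T.IsCanonicalRep hj σ₀ ρ) (h' : T.IsCanonicalRep hj σ₀ ρ') : ρ = ρ' := by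
  refine MonoidHom.ext fun g => ?_
  obtain ⟨γ, rfl⟩ := T.exists_facetPath_eq hj σ₀ g
  rw [h γ, h' γ]

/-- The inclusion of complements of skeleta maps paths in the dual graph to themselves. -/
theorem map_inclusion_toPath (T : Triangulation n S) {j j' : ℕ} (hjj' : j ≤ j') (hj : j + 3 ≤ n)
    (hj' : j' + 3 ≤ n) {σ σ' : S} (γ : T.FacetPath σ σ') :
    (γ.toPath hj').map (T.inclusion hjj').continuous = γ.toPath hj := by
  induction γ with
  | nil => rfl
  | cons i γ ih =>
    change ((T.dualEdge hj' _ i).trans (γ.toPath hj')).map (T.inclusion hjj').continuous =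
      (T.dualEdge hj _ i).trans (γ.toPath hj)
    rw [Path.map_trans, ih, dualEdge, Path.map_trans]
    rfl

/-- A canonical symmetric representation descends along an injective inclusion. -/
theorem exists_isCanonicalRep_of_injective [Finite S] (T : Triangulation n S) {j j' : ℕ}
    (hjj' : j ≤ j') (hj : j + 3 ≤ n) (hj' : j' + 3 ≤ n) (σ₀ : S)
    (hinj : Function.Injective (FundamentalGroup.map (T.inclusion hjj') (T.center hj' σ₀)))
    {ρ : FundamentalGroup (T.Complement j') (T.center hj' σ₀) →* Equiv.Perm (Fin (n + 1))}
    (hρ : T.IsCanonicalRep hj' σ₀ ρ) :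
    ∃ ρ : FundamentalGroup (T.Complement j) (T.center hj σ₀) →* Equiv.Perm (Fin (n + 1)),
      T.IsCanonicalRep hj σ₀ ρ := by
  let φ : FundamentalGroup (T.Complement j') (T.center hj' σ₀) →*
    FundamentalGroup (T.Complement j) (T.center hj σ₀) :=
      FundamentalGroup.map (T.inclusion hjj') (T.center hj' σ₀)
  have hφ : ∀ γ : T.FacetPath σ₀ σ₀,
      φ (FundamentalGroup.fromPath (Path.Homotopic.Quotient.mk (γ.toPath hj'))) =
        FundamentalGroup.fromPath (Path.Homotopic.Quotient.mk (γ.toPath hj)) := fun γ =>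
    congrArg Path.Homotopic.Quotient.mk (T.map_inclusion_toPath hjj' hj hj' γ)
  -- Facet loops avoid the larger skeleton too, so the inclusion is always surjective on fundamental
  -- groups; injectivity is all that is missing for an isomorphism.
  have hsurj : Function.Surjective φ := by
    intro g
    obtain ⟨γ, rfl⟩ := T.exists_facetPath_eq hj σ₀ g
    exact ⟨_, hφ γ⟩
  let e := MulEquiv.ofBijective φ ⟨hinj, hsurj⟩
  refine ⟨ρ.comp e.symm.toMonoidHom, fun γ => ?_⟩
  rw [← hρ γ, ← hφ γ]
  exact congrArg ρ (e.symm_apply_apply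
    (FundamentalGroup.fromPath (Path.Homotopic.Quotient.mk (γ.toPath hj'))) :)

end Triangulation

/-! ### Normal disc types -/

namespace NormalDiscType

variable {n : ℕ}

theorem compl_map (π : Equiv.Perm (Fin (n + 1))) (A : Finset (Fin (n + 1))) :
    (A.map π.toEmbedding)ᶜ = Aᶜ.map π.toEmbedding := by
  ext v
  simp

theorem coe_map (π : Equiv.Perm (Fin (n + 1))) (ν : NormalDiscType n) :
    (ν.map π).1 = ν.1.map (Finset.map π.toEmbedding) := rfl

/-- The action of a permutation of the corners on the normal disc types. -/
def mapEquiv (π : Equiv.Perm (Fin (n + 1))) : NormalDiscType n ≃ NormalDiscType n where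
  toFun ν := ν.map π
  invFun ν := ν.map π⁻¹
  left_inv ν := by
    change (ν.map π).map π⁻¹ = ν
    rw [← map_mul, inv_mul_cancel, map_one]
  right_inv ν := by
    change (ν.map π⁻¹).map π = ν
    rw [← map_mul, mul_inv_cancel, map_one]

theorem trace_map (π : Equiv.Perm (Fin (n + 1))) (ν : NormalDiscType n) (i : Fin (n + 1)) :
    (ν.map π).trace (π i) = (ν.trace i).map (Finset.map π.toEmbedding) := by
  unfold trace
  rw [coe_map, Sym2.map_map, Sym2.map_map]
  congr 1
  funext A
  exact (Finset.map_erase π.toEmbedding A i).symm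

theorem Separates.map {ν : NormalDiscType n} {a b : Fin (n + 1)} (h : ν.Separates a b)
    (π : Equiv.Perm (Fin (n + 1))) : (ν.map π).Separates (π a) (π b) := by
  obtain ⟨A, hA, ha, hb⟩ := h
  refine ⟨A.map π.toEmbedding, ?_, by simpa using ha, by simpa using hb⟩
  rw [compl_map, coe_map, ← hA]
  rfl

theorem midpoint_mem_disc {ν : NormalDiscType n} {a b : Fin (n + 1)} (h : ν.Separates a b) :
    midpoint ℝ (Pi.single a 1 : Fin (n + 1) → ℝ) (Pi.single b 1) ∈ ν.disc :=
  subset_convexHull ℝ _ ⟨a, b, h, rfl⟩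

theorem disc_subset_stdSimplex (ν : NormalDiscType n) : ν.disc ⊆ stdSimplex ℝ (Fin (n + 1)) := by
  refine convexHull_min ?_ (convex_stdSimplex ℝ _)
  rintro _ ⟨a, b, -, rfl⟩
  exact (convex_stdSimplex ℝ _).midpoint_mem (single_mem_stdSimplex ℝ a)
    (single_mem_stdSimplex ℝ b)

theorem isCompact_disc (ν : NormalDiscType n) : IsCompact ν.disc := by
  refine Set.Finite.isCompact_convexHull (𝕜 := ℝ) ?_
  refine (Set.finite_range fun p : Fin (n + 1) × Fin (n + 1) =>
    midpoint ℝ (Pi.single p.1 1 : Fin (n + 1) → ℝ) (Pi.single p.2 1)).subset ?_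
  rintro _ ⟨a, b, -, rfl⟩
  exact ⟨(a, b), rfl⟩

theorem permute_mem_disc {ν : NormalDiscType n} {x : stdSimplex ℝ (Fin (n + 1))}
    (hx : (x : Fin (n + 1) → ℝ) ∈ ν.disc) (π : Equiv.Perm (Fin (n + 1))) :
    (Triangulation.permute π x : Fin (n + 1) → ℝ) ∈ (ν.map π).disc := by
  have h : (Triangulation.permute π x : Fin (n + 1) → ℝ) ∈
      LinearMap.funLeft ℝ ℝ (π⁻¹ : Equiv.Perm (Fin (n + 1))) '' ν.disc := ⟨_, hx, rfl⟩
  unfold disc at h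
  rw [LinearMap.image_convexHull] at h
  refine convexHull_mono ?_ h
  rintro _ ⟨_, ⟨a, b, hab, rfl⟩, rfl⟩
  refine ⟨π a, π b, hab.map π, ?_⟩
  have hs : ∀ a, LinearMap.funLeft ℝ ℝ (π⁻¹ : Equiv.Perm (Fin (n + 1)))
      (Pi.single a 1 : Fin (n + 1) → ℝ) = Pi.single (π a) 1 := by
    intro a
    funext v
    rw [LinearMap.funLeft_apply, Pi.single_apply, Pi.single_apply]
    exact if_congr (Equiv.symm_apply_eq π) rfl rfl
  rw [← hs, ← hs]
  exact (LinearMap.funLeft ℝ ℝ (π⁻¹ : Equiv.Perm (Fin (n + 1)))).toAffineMap.map_midpoint _ _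

/-- The points of the simplex that belong to a disc. -/
abbrev DiscSet (ν : NormalDiscType n) : Type :=
  {x : stdSimplex ℝ (Fin (n + 1)) // (x : Fin (n + 1) → ℝ) ∈ ν.disc}

instance (ν : NormalDiscType n) : CompactSpace ν.DiscSet :=
  isCompact_iff_compactSpace.1 (((ν.isCompact_disc.isClosed).preimage
    continuous_subtype_val).isCompact (X := stdSimplex ℝ (Fin (n + 1))))

instance (ν : NormalDiscType n) : PreconnectedSpace ν.DiscSet := by
  refine Subtype.preconnectedSpace
    (s := {x : stdSimplex ℝ (Fin (n + 1)) | (x : Fin (n + 1) → ℝ) ∈ ν.disc}) ?_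
  rw [← Topology.IsInducing.subtypeVal.isPreconnected_image]
  have : Subtype.val '' {x : stdSimplex ℝ (Fin (n + 1)) | (x : Fin (n + 1) → ℝ) ∈ ν.disc} =
      ν.disc := by
    ext y
    constructor
    · rintro ⟨x, hx, rfl⟩
      exact hx
    · exact fun hy => ⟨⟨y, ν.disc_subset_stdSimplex hy⟩, hy, rfl⟩
  rw [this]
  exact (convex_convexHull ℝ _).isPreconnected

/-- A disc whose type has at least two corners on both sides meets all facets. -/
theorem IsType.exists_mem_disc {k : ℕ} (hk : 1 < k) (hk' : 2 * k ≤ n + 1) {ν : NormalDiscType n}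
    (h : ν.IsType k) (i : Fin (n + 1)) : ∃ x : ν.DiscSet, x.1 i = 0 := by
  obtain ⟨A, hA, h⟩ := h
  have hA' : 1 < Aᶜ.card := by
    rw [Finset.card_compl, Fintype.card_fin]
    omega
  -- Each part contains a corner other than `i`; the midpoint of the edge between two such corners
  -- is a vertex of the disc on the facet.
  obtain ⟨a, ha, hai⟩ := Finset.exists_mem_ne (hA ▸ hk : 1 < A.card) i
  obtain ⟨b, hb, hbi⟩ := Finset.exists_mem_ne hA' i
  have hsep : ν.Separates a b := ⟨A, h, ha, by simpa using hb⟩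
  refine ⟨⟨⟨_, ν.disc_subset_stdSimplex (midpoint_mem_disc hsep)⟩, midpoint_mem_disc hsep⟩, ?_⟩
  change midpoint ℝ (Pi.single a 1 : Fin (n + 1) → ℝ) (Pi.single b 1) i = 0
  rw [midpoint_eq_smul_add]
  simp [hai.symm, hbi.symm]

end NormalDiscType

/-! ### The number of disc types. -/

theorem compl_eq_of_mk_eq {α : Type*} [Fintype α] [DecidableEq α] {A B : Finset α}
    (h : s(A, Aᶜ) = s(B, Bᶜ)) : A = B ∨ A = Bᶜ := by
  rw [Sym2.eq_iff] at h
  rcases h with ⟨h, -⟩ | ⟨h, -⟩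
  · exact Or.inl h
  · exact Or.inr h

/-- The type of the disc that separates the corners in `A` from the other ones. -/
def discTypeOfFinset {n k : ℕ} (hk : 1 < k) (hk' : 2 * k ≤ n + 1)
    (A : {A : Finset (Fin (n + 1)) // A.card = k}) : DiscType n k :=
  ⟨⟨s(A.1, A.1ᶜ), A.1, Finset.card_pos.1 (by rw [A.2]; omega), Finset.card_pos.1 (by
    rw [Finset.card_compl, Fintype.card_fin, A.2]; omega), rfl⟩, A.1, A.2, rfl⟩

instance (n k : ℕ) : Finite (DiscType n k) := inferInstanceAs (Finite (Subtype _))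

/-- A partition comes from exactly one `k`-element set, unless both parts have `k` elements, when it
comes from two. -/
theorem card_discType {n k : ℕ} (hk : 1 < k) (hk' : 2 * k ≤ n + 1) :
    Nat.card (DiscType n k) = numPartitions n k := by
  classical
  have hsurj : Function.Surjective (discTypeOfFinset (n := n) hk hk') := by
    rintro ⟨ν, A, hA, h⟩
    exact ⟨⟨A, hA⟩, Subtype.ext (Subtype.ext h)⟩
  have heq : ∀ A B, discTypeOfFinset (n := n) hk hk' A = discTypeOfFinset hk hk' B →
      A = B ∨ A.1 = B.1ᶜ := fun A B h => by
    rcases compl_eq_of_mk_eq (congrArg (fun ν : DiscType n k => ν.1.1) h) with h | h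
    · exact Or.inl (Subtype.ext h)
    · exact Or.inr h
  have hcard : Fintype.card {A : Finset (Fin (n + 1)) // A.card = k} = (n + 1).choose k := by
    simp
  unfold numPartitions
  split_ifs with h2
  · have := Fintype.ofFinite (DiscType n k)
    have hfib : ∀ ν : DiscType n k,
        (Finset.univ.filter fun A => discTypeOfFinset hk hk' A = ν).card = 2 := by
      intro ν
      obtain ⟨A, rfl⟩ := hsurj ν
      have hc : A.1ᶜ.card = k := by
        rw [Finset.card_compl, Fintype.card_fin, A.2]; omega
      have hne : A ≠ ⟨A.1ᶜ, hc⟩ := fun h => by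
        have h1 : A.1 = A.1ᶜ := congrArg Subtype.val h
        obtain ⟨a, ha⟩ : A.1.Nonempty := Finset.card_pos.1 (by rw [A.2]; omega)
        have h3 := ha
        rw [h1, Finset.mem_compl] at h3
        exact h3 ha
      rw [← Finset.card_pair hne]
      congr 1
      ext B
      simp only [Finset.mem_filter, Finset.mem_univ, true_and, Finset.mem_insert,
        Finset.mem_singleton]
      constructor
      · intro h
        rcases heq _ _ h with h | h
        · exact Or.inl h
        · exact Or.inr (Subtype.ext h)
      · rintro (rfl | rfl)
        · rfl
        · refine Subtype.ext (Subtype.ext ?_)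
          change s(A.1ᶜ, A.1ᶜᶜ) = s(A.1, A.1ᶜ)
          rw [compl_compl, Sym2.eq_swap]
    have := Finset.card_eq_sum_card_fiberwise (s := Finset.univ) (t := Finset.univ)
      (f := discTypeOfFinset (n := n) hk hk') (fun _ _ => by simp)
    rw [Finset.sum_congr rfl fun ν _ => hfib ν, Finset.sum_const, Finset.card_univ, hcard,
      Finset.card_univ, smul_eq_mul] at this
    rw [Nat.card_eq_fintype_card]
    omega
  · rw [← hcard, ← Nat.card_eq_fintype_card]
    refine (Nat.card_congr (Equiv.ofBijective _ ⟨fun A B h => ?_, hsurj⟩)).symm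
    rcases heq A B h with h | h
    · exact h
    · have := congrArg Finset.card h
      rw [Finset.card_compl, Fintype.card_fin, A.2, B.2] at this
      omega

namespace Triangulation

variable {n : ℕ} {S : Type*}

/-! ### Inverse facet paths and connectedness of the dual graph -/

/-- The end simplex is given by an equation, because crossing a facet twice returns to the start
only propositionally. -/
theorem exists_facetPath_step (T : Triangulation n S) (τ : S × Fin (n + 1)) {σ' : S}
    (h : (T.pairing τ).1 = σ') :
    ∃ γ : T.FacetPath τ.1 σ', γ.projectivity = T.perspectivity τ := by
  subst h
  exact ⟨.cons τ.2 (.nil _), one_mul _⟩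

theorem FacetPath.exists_inverse {T : Triangulation n S} {σ σ' : S} (γ : T.FacetPath σ σ') :
    ∃ γ' : T.FacetPath σ' σ, γ'.projectivity = γ.projectivity⁻¹ := by
  induction γ with
  | nil σ => exact ⟨.nil σ, inv_one.symm⟩
  | @cons σ σ' i γ ih =>
    obtain ⟨γ', h⟩ := ih
    obtain ⟨γ'', h'⟩ := T.exists_facetPath_step (T.pairing (σ, i)) (σ' := σ)
      (by rw [T.pairing_pairing])
    refine ⟨γ'.append γ'', ?_⟩
    rw [projectivity_append, h, h', T.perspectivity_pairing]
    exact (mul_inv_rev _ _).symm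

theorem isOpen_of_forall_mem_iff {X : Type*} [TopologicalSpace X] {U : Set X} {p : Prop}
    (h : ∀ x, x ∈ U ↔ p) : IsOpen U := by
  have : U = {_x | p} := Set.ext h
  rw [this]
  exact isOpen_const

/-- Reachability of the simplex containing a point is invariant under gluing and constant on
simplices, so it defines a clopen set. -/
theorem nonempty_facetPath (T : Triangulation n S) [ConnectedSpace T.Space] (σ₀ σ : S) :
    Nonempty (T.FacetPath σ₀ σ) := by
  let f : T.Space → Prop := Quot.lift (fun p : T.Points => Nonempty (T.FacetPath σ₀ p.1)) (by
    rintro p q ⟨i, -, h, -⟩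
    refine propext ⟨fun ⟨γ⟩ => ?_, fun ⟨γ⟩ => ?_⟩
    · obtain ⟨γ', -⟩ := T.exists_facetPath_step (p.1, i) h.symm
      exact ⟨γ.append γ'⟩
    · obtain ⟨γ', -⟩ := T.exists_facetPath_step (p.1, i) h.symm
      exact ⟨γ.append γ'.exists_inverse.choose⟩)
  have hf : IsClopen {q | f q} := by
    refine ⟨⟨?_⟩, ?_⟩
    · rw [← isQuotientMap_quot_mk.isOpen_preimage, isOpen_sigma_iff]
      exact fun σ => isOpen_of_forall_mem_iff (p := ¬Nonempty (T.FacetPath σ₀ σ)) fun _ => Iff.rfl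
    · rw [← isQuotientMap_quot_mk.isOpen_preimage, isOpen_sigma_iff]
      exact fun σ => isOpen_of_forall_mem_iff (p := Nonempty (T.FacetPath σ₀ σ)) fun _ => Iff.rfl
  obtain ⟨x⟩ : Nonempty (stdSimplex ℝ (Fin (n + 1))) := inferInstance
  have := hf.eq_univ ⟨T.proj σ₀ x, ⟨FacetPath.nil σ₀⟩⟩
  have h : T.proj σ x ∈ {q | f q} := this ▸ mem_univ _
  exact h

/-! ### Components of the hypersurface -/

section Components

variable (T : Triangulation n S) {k : ℕ}

/-- The disc that is reached from a disc along a facet path. -/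
def DiscReaches (d d' : S × DiscType n k) : Prop :=
  ∃ γ : T.FacetPath d.1 d'.1, d'.2 = discAction n k γ.projectivity d.2

variable {T}

theorem DiscReaches.trans {d d' d'' : S × DiscType n k} (h : T.DiscReaches d d')
    (h' : T.DiscReaches d' d'') : T.DiscReaches d d'' := by
  obtain ⟨γ, h⟩ := h
  obtain ⟨γ', h'⟩ := h'
  refine ⟨γ.append γ', ?_⟩
  rw [FacetPath.projectivity_append, map_mul, h', h]
  rfl

theorem DiscReaches.symm {d d' : S × DiscType n k} (h : T.DiscReaches d d') :
    T.DiscReaches d' d := by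
  obtain ⟨γ, h⟩ := h
  obtain ⟨γ', h'⟩ := γ.exists_inverse
  refine ⟨γ', ?_⟩
  rw [h', h, map_inv]
  exact (Equiv.symm_apply_apply _ _).symm

theorem discReaches_of_discIdentifies {p q : T.DiscPoints k} (h : T.DiscIdentifies k p q) :
    T.DiscReaches p.1 q.1 := by
  obtain ⟨i, -, h1, h2, -⟩ := h
  obtain ⟨γ, hγ⟩ := T.exists_facetPath_step (p.1.1, i) h1.symm
  exact ⟨γ, by rw [hγ, h2]⟩

/-- The point of the hypersurface in the disc of type `ν` in `σ`. -/
abbrev discProj (T : Triangulation n S) {k : ℕ} (d : S × DiscType n k) (x : d.2.1.DiscSet) :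
    T.Hypersurface k :=
  Quot.mk _ ⟨d, x⟩

theorem continuous_discProj (d : S × DiscType n k) : Continuous (T.discProj d) :=
  continuous_quot_mk.comp (continuous_sigmaMk
    (σ := fun d : S × DiscType n k => d.2.1.DiscSet))

theorem discProj_permute {d : S × DiscType n k} (x : d.2.1.DiscSet) {i : Fin (n + 1)}
    (hi : x.1 i = 0) : T.discProj d x =
      T.discProj ((T.pairing (d.1, i)).1, discAction n k (T.perspectivity (d.1, i)) d.2)
        ⟨permute (T.perspectivity (d.1, i)) x.1, NormalDiscType.permute_mem_disc x.2 _⟩ :=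
  Quot.sound ⟨i, hi, rfl, rfl, fun v => permute_apply_apply _ x.1 v⟩

theorem discProj_congr {d d' : S × DiscType n k} (hd : d = d') {x : d.2.1.DiscSet}
    {x' : d'.2.1.DiscSet} (hx : x.1 = x'.1) : T.discProj d x = T.discProj d' x' := by
  subst hd
  rw [Subtype.ext hx]

/-- Discs with points in the same component of the hypersurface are reached from each other. -/
theorem discReaches_of_coe_eq {d d' : S × DiscType n k} {x : d.2.1.DiscSet} {x' : d'.2.1.DiscSet}
    (h : (T.discProj d x : ConnectedComponents (T.Hypersurface k)) = T.discProj d' x') :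
    T.DiscReaches d d' := by
  -- Reachability is constant on each disc and respects the gluing, so it defines a clopen set that
  -- contains the whole component.
  let f : T.Hypersurface k → Prop := Quot.lift (fun p => T.DiscReaches d p.1) fun p q h =>
    propext ⟨fun h' => h'.trans (discReaches_of_discIdentifies h),
      fun h' => h'.trans (discReaches_of_discIdentifies h).symm⟩
  have hf : IsClopen {q | f q} := by
    refine ⟨⟨?_⟩, ?_⟩
    · rw [← isQuotientMap_quot_mk.isOpen_preimage, isOpen_sigma_iff]
      exact fun d' => isOpen_of_forall_mem_iff (p := ¬T.DiscReaches d d') fun _ => Iff.rfl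
    · rw [← isQuotientMap_quot_mk.isOpen_preimage, isOpen_sigma_iff]
      exact fun d' => isOpen_of_forall_mem_iff (p := T.DiscReaches d d') fun _ => Iff.rfl
  have hx : T.discProj d x ∈ {q | f q} := ⟨.nil _, by simp [FacetPath.projectivity]⟩
  have := hf.connectedComponent_subset hx
  rw [ConnectedComponents.coe_eq_coe.1 h] at this
  exact this mem_connectedComponent

theorem coe_discProj_eq_of_same (d : S × DiscType n k) (x x' : d.2.1.DiscSet) :
    (T.discProj d x : ConnectedComponents (T.Hypersurface k)) = T.discProj d x' := by
  rw [ConnectedComponents.coe_eq_coe']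
  exact (isPreconnected_range (continuous_discProj d)).subset_connectedComponent ⟨x', rfl⟩ ⟨x, rfl⟩

/-- Discs are connected and meet every facet, so crossing any facet stays in the component. A part
with a single corner would produce discs that miss a facet. -/
theorem coe_discProj_eq_of_discReaches (hk : 1 < k) (hk' : 2 * k ≤ n + 1) {σ σ' : S}
    (γ : T.FacetPath σ σ') (ν : DiscType n k) (x : ν.1.DiscSet)
    (x' : (discAction n k γ.projectivity ν).1.DiscSet) :
    (T.discProj (σ, ν) x : ConnectedComponents (T.Hypersurface k)) =
      T.discProj (σ', discAction n k γ.projectivity ν) x' := by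
  induction γ generalizing ν with
  | nil σ =>
    have : discAction n k (FacetPath.projectivity (T := T) (.nil σ)) ν = ν := by
      simp [FacetPath.projectivity]
    generalize discAction n k (FacetPath.projectivity (T := T) (.nil σ)) ν = ν' at x' this
    subst this
    exact coe_discProj_eq_of_same (σ, _) x x'
  | @cons σ σ' i γ ih =>
    obtain ⟨z, hz⟩ := ν.2.exists_mem_disc hk hk' i
    rw [coe_discProj_eq_of_same (σ, ν) x z, discProj_permute (d := (σ, ν)) z hz]
    have h := ih (discAction n k (T.perspectivity (σ, i)) ν)
      ⟨permute (T.perspectivity (σ, i)) z.1, NormalDiscType.permute_mem_disc z.2 _⟩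
    have he : discAction n k (FacetPath.projectivity (.cons i γ)) ν =
        discAction n k γ.projectivity (discAction n k (T.perspectivity (σ, i)) ν) := by
      change discAction n k (_ * _) ν = _
      rw [map_mul]
      rfl
    generalize discAction n k (FacetPath.projectivity (.cons i γ)) ν = ν' at x' he
    subst he
    exact h x'

theorem exists_discSet (hk : 1 < k) (hk' : 2 * k ≤ n + 1) (d : S × DiscType n k) :
    Nonempty d.2.1.DiscSet :=
  ⟨(d.2.2.exists_mem_disc hk hk' 0).choose⟩

theorem coe_discProj_eq_iff (hk : 1 < k) (hk' : 2 * k ≤ n + 1) {d d' : S × DiscType n k}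
    {x : d.2.1.DiscSet} {x' : d'.2.1.DiscSet} :
    (T.discProj d x : ConnectedComponents (T.Hypersurface k)) = T.discProj d' x' ↔
      T.DiscReaches d d' := by
  refine ⟨discReaches_of_coe_eq, ?_⟩
  obtain ⟨σ, ν⟩ := d
  obtain ⟨σ', ν'⟩ := d'
  rintro ⟨γ, h⟩
  dsimp only at γ h
  subst h
  exact coe_discProj_eq_of_discReaches hk hk' γ ν x x'

variable (T)

/-- The component of the hypersurface that contains the disc `d`. -/
noncomputable def componentOf (hk : 1 < k) (hk' : 2 * k ≤ n + 1) (d : S × DiscType n k) :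
    ConnectedComponents (T.Hypersurface k) :=
  (T.discProj d (exists_discSet hk hk' d).some : T.Hypersurface k)

variable (hk : 1 < k) (hk' : 2 * k ≤ n + 1)

theorem coe_discProj (d : S × DiscType n k) (x : d.2.1.DiscSet) :
    (T.discProj d x : ConnectedComponents (T.Hypersurface k)) = T.componentOf hk hk' d :=
  coe_discProj_eq_of_same d _ _

theorem componentOf_eq_iff {d d' : S × DiscType n k} :
    T.componentOf hk hk' d = T.componentOf hk hk' d' ↔ T.DiscReaches d d' :=
  coe_discProj_eq_iff hk hk'

theorem componentOf_projectivity {σ σ' : S} (γ : T.FacetPath σ σ') (ν : DiscType n k) :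
    T.componentOf hk hk' (σ', discAction n k γ.projectivity ν) = T.componentOf hk hk' (σ, ν) :=
  ((T.componentOf_eq_iff hk hk').2 ⟨γ, rfl⟩).symm

theorem mem_discTypes_component_iff {c : ConnectedComponents (T.Hypersurface k)} {σ : S}
    {ν : DiscType n k} :
    ν ∈ T.discTypes (T.component c) σ ↔ T.componentOf hk hk' (σ, ν) = c := by
  constructor
  · intro h
    exact h ⟨(exists_discSet hk hk' (σ, ν)).some, rfl⟩
  · rintro rfl _ ⟨x, rfl⟩
    exact T.coe_discProj hk hk' (σ, ν) x

/-- Any disc of the component can be carried to `σ₀` along a facet path. -/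
theorem exists_componentOf_eq [ConnectedSpace T.Space] (σ₀ : S)
    (c : ConnectedComponents (T.Hypersurface k)) : ∃ ν, T.componentOf hk hk' (σ₀, ν) = c := by
  obtain ⟨q, rfl⟩ := ConnectedComponents.surjective_coe c
  obtain ⟨⟨⟨σ, ν⟩, x⟩, rfl⟩ := Quot.exists_rep q
  obtain ⟨γ⟩ := T.nonempty_facetPath σ σ₀
  exact ⟨_, (T.componentOf_projectivity hk hk' γ ν).trans (T.coe_discProj hk hk' _ _).symm⟩

/-- The hypersurface has as many components as there are disc types if and only if different discs
in a simplex belong to different components. -/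
theorem card_components_eq_iff [ConnectedSpace T.Space] (σ₀ : S) :
    Nat.card (ConnectedComponents (T.Hypersurface k)) = numPartitions n k ↔
      Function.Injective fun ν => T.componentOf hk hk' (σ₀, ν) := by
  have hsurj : Function.Surjective fun ν => T.componentOf hk hk' (σ₀, ν) :=
    T.exists_componentOf_eq hk hk' σ₀
  rw [← card_discType hk hk']
  constructor
  · intro h
    exact (hsurj.bijective_of_nat_card_le h.ge).1
  · intro h
    exact (Nat.card_congr (Equiv.ofBijective _ ⟨h, hsurj⟩)).symm

theorem injective_componentOf [ConnectedSpace T.Space] {σ₀ : S}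
    (h : Function.Injective fun ν => T.componentOf hk hk' (σ₀, ν)) (σ : S) :
    Function.Injective fun ν => T.componentOf hk hk' (σ, ν) := by
  intro ν ν' he
  obtain ⟨γ⟩ := T.nonempty_facetPath σ σ₀
  refine (discAction n k γ.projectivity).injective (h ?_)
  change T.componentOf hk hk' _ = T.componentOf hk hk' _
  rw [componentOf_projectivity, componentOf_projectivity]
  exact he

/-! ### Embeddedness of the components -/

variable {T} {hk hk'} in
-- Every identification of points in the pseudo-manifold lifts to the hypersurface if the disc type
-- is carried along.
theorem discProj_eq_of_reaches {d : S × DiscType n k} (x : d.2.1.DiscSet) {g : T.Frame}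
    (h : T.Reaches (zeros x.1) (d.1, 1) g) : T.discProj d x =
      T.discProj (g.1, discAction n k g.2 d.2)
        ⟨permute g.2 x.1, NormalDiscType.permute_mem_disc x.2 _⟩ := by
  induction h with
  | refl =>
    refine discProj_congr ?_ ?_
    · refine Prod.ext rfl ?_
      exact (DFunLike.congr_fun (map_one (discAction n k)) d.2).symm
    · rfl
  | @tail g _ _ h ih =>
    obtain ⟨v, hv, rfl⟩ := h
    rw [ih, discProj_permute (d := (g.1, discAction n k g.2 d.2)) (i := g.2 v) _
      ((permute_apply_apply g.2 x.1 v).trans hv)]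
    refine discProj_congr ?_ ?_
    · refine Prod.ext rfl ?_
      exact (DFunLike.congr_fun (map_mul (discAction n k) _ _) d.2).symm
    · rfl

theorem continuous_toSpace : Continuous (Hypersurface.toSpace T k) :=
  continuous_quot_lift _ (continuous_sigma fun d =>
    (T.continuous_proj d.1).comp continuous_subtype_val)

theorem discTypes_map (hk : 1 < k) (hk' : 2 * k ≤ n + 1)
    {c : ConnectedComponents (T.Hypersurface k)} {σ : S} {i : Fin (n + 1)}
    {ν : DiscType n k} :
    discAction n k (T.perspectivity (σ, i)) ν ∈
        T.discTypes (T.component c) (T.pairing (σ, i)).1 ↔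
      ν ∈ T.discTypes (T.component c) σ := by
  rw [T.mem_discTypes_component_iff hk hk', T.mem_discTypes_component_iff hk hk']
  have h := T.componentOf_projectivity hk hk' (σ := σ) (.cons i (.nil _)) ν
  simp only [FacetPath.projectivity, one_mul] at h
  rw [h]

theorem normalCoordinate_map (hk : 1 < k) (hk' : 2 * k ≤ n + 1)
    (c : ConnectedComponents (T.Hypersurface k)) (σ : S)
    (i : Fin (n + 1)) (ν : NormalDiscType n) :
    T.normalCoordinate (T.component c) (T.pairing (σ, i)).1 (ν.map (T.perspectivity (σ, i))) =
      T.normalCoordinate (T.component c) σ ν := by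
  classical
  unfold normalCoordinate
  refine if_congr ⟨?_, ?_⟩ rfl rfl
  · rintro ⟨h, h'⟩
    have h1 := h.map (T.perspectivity (σ, i))⁻¹
    rw [← NormalDiscType.map_mul, inv_mul_cancel, NormalDiscType.map_one] at h1
    exact ⟨h1, (T.discTypes_map hk hk' (ν := ⟨ν, h1⟩)).1 h'⟩
  · rintro ⟨h, h'⟩
    exact ⟨h.map _, (T.discTypes_map hk hk' (ν := ⟨ν, h⟩)).2 h'⟩

/-- The perspectivity matches the terms of the two sums: it preserves membership in the component
and is compatible with traces on the facet. -/
theorem matchingEquations_component (hk : 1 < k) (hk' : 2 * k ≤ n + 1)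
    (c : ConnectedComponents (T.Hypersurface k)) :
    T.MatchingEquations (T.normalCoordinate (T.component c)) := by
  intro σ i B B' _ _ _ _
  refine Finset.sum_equiv (NormalDiscType.mapEquiv (T.perspectivity (σ, i))) (fun ν => ?_)
    fun ν _ => (T.normalCoordinate_map hk hk' c σ i ν).symm
  simp only [Finset.mem_filter, Finset.mem_univ, true_and]
  have h : (NormalDiscType.mapEquiv (T.perspectivity (σ, i)) ν).trace (T.pairing (σ, i)).2 =
      (ν.trace i).map (Finset.map (T.perspectivity (σ, i)).toEmbedding) := by
    rw [← T.perspectivity_self]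
    exact NormalDiscType.trace_map _ ν i
  rw [h]
  exact (Sym2.map.injective (Finset.map_injective _)).eq_iff.symm

theorem isEmbeddedNormalHypersurface_component [Finite S]
    (h : ∀ σ, Function.Injective fun ν => T.componentOf hk hk' (σ, ν))
    (c : ConnectedComponents (T.Hypersurface k)) :
    T.IsEmbeddedNormalHypersurface (T.component c) where
  nonempty := ConnectedComponents.surjective_coe c
  eq_union := by
    ext q
    simp only [mem_iUnion]
    constructor
    · obtain ⟨⟨⟨σ, ν⟩, x⟩, rfl⟩ := Quot.exists_rep q
      intro hq
      refine ⟨σ, ν, (T.mem_discTypes_component_iff hk hk').2 ?_, ⟨x, rfl⟩⟩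
      exact (T.coe_discProj hk hk' (σ, ν) x).symm.trans hq
    · rintro ⟨σ, ν, hν, hq⟩
      exact hν hq
  matching := T.matchingEquations_component hk hk' c
  isEmbedding := by
    -- A continuous injection of a compact space into a Hausdorff space is an embedding, so only
    -- injectivity needs the hypothesis on the components.
    have := T.t2Space
    have hcomp : CompactSpace (T.Hypersurface k) := by
      have : CompactSpace (T.DiscPoints k) :=
        inferInstanceAs (CompactSpace (Σ d : S × DiscType n k, d.2.1.DiscSet))
      infer_instance
    have hclosed : IsClosed (T.component c) := by
      obtain ⟨q, rfl⟩ := ConnectedComponents.surjective_coe c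
      change IsClosed (ConnectedComponents.mk ⁻¹' {ConnectedComponents.mk q})
      rw [connectedComponents_preimage_singleton]
      exact isClosed_connectedComponent
    have : CompactSpace (T.component c) := isCompact_iff_compactSpace.1 hclosed.isCompact
    refine (Continuous.isClosedEmbedding
      ((T.continuous_toSpace).comp continuous_subtype_val) ?_).isEmbedding
    rintro ⟨q, hq⟩ ⟨q', hq'⟩ he
    obtain ⟨⟨⟨σ, ν⟩, x⟩, rfl⟩ := Quot.exists_rep q
    obtain ⟨⟨⟨σ', ν'⟩, x'⟩, rfl⟩ := Quot.exists_rep q'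
    obtain ⟨π, hπ, hx⟩ := T.proj_eq_proj_iff.1 (show T.proj σ x.1 = T.proj σ' x'.1 from he)
    -- The first point also lies in the disc of type `π ν` in `σ'`. This disc and the one of type
    -- `ν'` are in the same component and the same simplex, hence they coincide.
    have h1 := discProj_eq_of_reaches (d := (σ, ν)) x hπ
    have h2 : T.componentOf hk hk' (σ', discAction n k π ν) = T.componentOf hk hk' (σ', ν') := by
      rw [← T.coe_discProj hk hk' (σ', ν') x', ← T.coe_discProj hk hk' (σ', discAction n k π ν)
        ⟨permute π x.1, NormalDiscType.permute_mem_disc x.2 _⟩, ← h1]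
      exact hq.trans hq'.symm
    have h3 : discAction n k π ν = ν' := h σ' h2
    refine Subtype.ext (h1.trans ?_)
    refine discProj_congr ?_ ?_
    · exact Prod.ext rfl h3
    · exact hx.symm

end Components

end Triangulation

/-! ### The main theorem. -/

theorem mainTheorem7 {n : ℕ} (hn : 3 ≤ n) {S : Type*} [Finite S] (T : Triangulation n S)
    [ConnectedSpace T.Space] (hT : T.IsEven) (σ₀ : S) {k : ℕ} (hk : 1 < k)
    (hk' : 2 * k ≤ n + 1) (j : ℕ) (hj : j + 3 ≤ n) :
    ((4 ≤ n → T.NoFolding ∧ Function.Injective (FundamentalGroup.map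
          (T.inclusion (Nat.le_sub_of_add_le hj))
          (T.center (Nat.sub_add_cancel hn).le σ₀))) →
      ∃! ρ : FundamentalGroup (T.Complement j) (T.center hj σ₀) →* Equiv.Perm (Fin (n + 1)),
        T.IsCanonicalRep hj σ₀ ρ) ∧
    ∀ ρ : FundamentalGroup (T.Complement j) (T.center hj σ₀) →* Equiv.Perm (Fin (n + 1)),
      T.IsCanonicalRep hj σ₀ ρ →
      (∀ (c : ConnectedComponents (T.Hypersurface k))
          (g : FundamentalGroup (T.Complement j) (T.center hj σ₀)),
        (inducedRep ρ k g) '' T.discTypes (T.component c) σ₀ =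
          T.discTypes (T.component c) σ₀) ∧
      ((inducedRep ρ k).range = ⊥ ↔
        Nat.card (ConnectedComponents (T.Hypersurface k)) = numPartitions n k) ∧
      (Nat.card (ConnectedComponents (T.Hypersurface k)) = numPartitions n k →
        ∀ c : ConnectedComponents (T.Hypersurface k),
          T.IsEmbeddedNormalHypersurface (T.component c)) := by
  refine ⟨fun h => ?_, fun ρ hρ => ?_⟩
  · suffices ∃ ρ : FundamentalGroup (T.Complement j) (T.center hj σ₀) →* Equiv.Perm (Fin (n + 1)),
        T.IsCanonicalRep hj σ₀ ρ by
      obtain ⟨ρ, hρ⟩ := this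
      exact ⟨ρ, hρ, fun ρ' hρ' => hρ'.unique hρ⟩
    rcases Nat.lt_or_eq_of_le hn with hn4 | hn3
    · obtain ⟨hfold, hinj⟩ := h hn4
      -- The monodromy is controlled only outside the `(n-3)`-skeleton; the representation found
      -- there is then transported to the complement of the `j`-skeleton.
      have hm : T.TrivialMonodromy (n - 3) :=
        T.trivialMonodromy hT (T.rigidFaces_of_noFolding hfold) (by omega)
      obtain ⟨ρ, hρ⟩ := T.exists_isCanonicalRep hm (Nat.sub_add_cancel hn).le σ₀
      exact T.exists_isCanonicalRep_of_injective (Nat.le_sub_of_add_le hj) hj _ σ₀ hinj hρ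
    · have hm : T.TrivialMonodromy j :=
        T.trivialMonodromy hT (T.rigidFaces_of_eq_three hn3.symm) (by omega)
      exact T.exists_isCanonicalRep hm hj σ₀
  · have hfix : ∀ (γ : T.FacetPath σ₀ σ₀) (ν : DiscType n k),
        T.componentOf hk hk' (σ₀, discAction n k γ.projectivity ν) =
          T.componentOf hk hk' (σ₀, ν) := fun γ ν => T.componentOf_projectivity hk hk' γ ν
    refine ⟨fun c g => ?_, ?_, fun h => ?_⟩
    · obtain ⟨γ, rfl⟩ := T.exists_facetPath_eq hj σ₀ g
      change (discAction n k (ρ _)) '' _ = _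
      rw [hρ γ]
      ext ν
      rw [Equiv.image_eq_preimage_symm, mem_preimage, T.mem_discTypes_component_iff hk hk',
        T.mem_discTypes_component_iff hk hk', ← hfix γ, Equiv.apply_symm_apply]
    · rw [T.card_components_eq_iff hk hk' σ₀, MonoidHom.range_eq_bot_iff]
      constructor
      · intro h1 ν ν' he
        -- Two discs of `σ₀` in one component are related by the projectivity of a facet loop, which
        -- acts trivially on disc types.
        obtain ⟨γ, hγ⟩ := (T.componentOf_eq_iff hk hk').1 he
        have h2 : discAction n k (ρ _) = 1 := DFunLike.congr_fun h1
          (FundamentalGroup.fromPath (Path.Homotopic.Quotient.mk (γ.toPath hj)))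
        rw [hρ γ] at h2
        rw [h2] at hγ
        exact hγ.symm
      · intro hinj
        refine MonoidHom.ext fun g => ?_
        obtain ⟨γ, rfl⟩ := T.exists_facetPath_eq hj σ₀ g
        change discAction n k (ρ _) = 1
        rw [hρ γ]
        -- A projectivity keeps each disc in its component, and a component has only one disc in
        -- `σ₀`.
        exact Equiv.ext fun ν => hinj (hfix γ ν)
    · exact T.isEmbeddedNormalHypersurface_component hk hk'
        (T.injective_componentOf hk hk' ((T.card_components_eq_iff hk hk' σ₀).1 h))
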